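/- Let $\Omega\subset\mathbb{R}^n$ be open, $1\le p\le\infty$, let $A:L^p(\Omega)\to L^p(\Omega)$ be a bounded linear operator on the real space $L^p(\Omega)$, let $u_0\in L^p(\Omega)$, and let $\alpha\in L^\infty(\Omega)$ satisfy $\alpha(x)\in[\alpha_0,1]$ for a.e. $x\in\Omega$, for some $\alpha_0\in(0,1)$. For $\beta>0$ let $J_t^{\beta}f(t)=\frac{1}{\Gamma(\beta)}\int_0^t(t-s)^{\beta-1}f(s)\,ds$, and $J_t^0f=f$. A function $u\in C([0,\infty);L^p(\Omega))$ is a *solution* of $$cD_t^{\alpha(x)}u(t,x)=Au(t,x),\qquad u(0,x)=u_0(x),\tag{P}$$ if $u(0)=u_0$ and, for a jointly measurable representative $u(t,x)$, for every $t\ge0$ the integral $K(t,x)=J_t^{1-\alpha(x)}\big[u(\cdot,x)-u(0,x)\big](t)$ exists for a.e. $x$, $K(t,\cdot)\in L^p(\Omega)$, and $K:[0,\infty)\to L^p(\Omega)$ is differentiable with $K'(t)=Au(t)$ for every $t\ge0$ (one-sided derivative at $t=0$). Suppose that for every $\phi\in L^p(\Omega)$ and every $s\ge0$, $$\frac{s^{\alpha(x)}}{\Gamma(\alpha(x)+1)}\,(A\phi)(x)=A\!\left(\frac{s^{\alpha(\cdot)}}{\Gamma(\alpha(\cdot)+1)}\,\phi\right)(x)\qquad\text{for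 a.e. }x\in\Omega .$$ Then the variable-order Mittag-Leffler series $$u(t,x)=E_{\alpha(x)}\big(t^{\alpha(x)}A\big)u_0(x):=\sum_{k=0}^\infty\frac{t^{\alpha(x)k}A^ku_0(x)}{\Gamma(\alpha(x)k+1)}$$ converges in $L^p(\Omega)$ for every $t\ge0$, and also pointwise for a.e. $x\in\Omega$ and all $t\ge0$, with the same sum, and $u$ is the unique solution of (P) on $[0,\infty)$. Moreover, for the pointwise sum $u(t,x)$, the integral $J_t^{1-\alpha(x)}[u(\cdot,x)-u(0,x)](t)$ exists for a.e. $x\in\Omega$ and all $t\ge0$, and for every $t\ge0$ the classical derivative $\frac{d}{dt}J_t^{1-\alpha(x)}[u(\cdot,x)-u(0,x)](t)$ exists and equals $(Au(t))(x)$ for a.e. $x\in\Omega$. -/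

import Mathlib

open MeasureTheory Set
open scoped ENNReal

noncomputable section

/-- The Riemann-Liouville integral of order `β` of a function of time, at time `t`:
`1 / Γ(β) * ∫₀ᵗ (t - s)^(β - 1) f(s) ds` for `β > 0`, and `f(t)` for `β = 0`. -/
def rlIntegral (β : ℝ) (f : ℝ → ℝ) (t : ℝ) : ℝ :=
  if β = 0 then f t
  else 1 / Real.Gamma β * ∫ s in (0 : ℝ)..t, (t - s) ^ (β - 1) * f s

/-- The right-hand side of the definition of the Riemann-Liouville integral exists. -/
def RLIntegralExists (β : ℝ) (f : ℝ → ℝ) (t : ℝ) : Prop :=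
  β = 0 ∨ IntervalIntegrable (fun s => (t - s) ^ (β - 1) * f s) volume 0 t

/-- `φ(t, x)` is a jointly measurable representative of `u : I → L^p`. -/
def IsRepresentative {X : Type*} [MeasurableSpace X] {μ : Measure X} {p : ℝ≥0∞}
    (I : Set ℝ) (u : ℝ → Lp ℝ p μ) (φ : ℝ → X → ℝ) : Prop :=
  AEStronglyMeasurable (Function.uncurry φ) ((volume.restrict I).prod μ) ∧
    ∀ t ∈ I, φ t =ᵐ[μ] u t

/-- `w` is the Caputo derivative of variable order `α(x)` of `u : I → L^p` on `I`. That is, for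
every `t ∈ I` the fractional integral `K(t)` of order `1 - α(x)` of `u - u(0)`, taken pointwise
in `x`, exists for almost every `x` and lies in `L^p`, and the `L^p`-valued function `K` is
differentiable on `I` with derivative `w`. The class `K(t)` does not depend on the chosen
representative. -/
def HasCaputoDerivOn {X : Type*} [MeasurableSpace X] {μ : Measure X} {p : ℝ≥0∞}
    [Fact (1 ≤ p)] (I : Set ℝ) (α : X → ℝ) (u w : ℝ → Lp ℝ p μ) : Prop :=
  ∃ φ : ℝ → X → ℝ, IsRepresentative I u φ ∧
    ∃ K : ℝ → Lp ℝ p μ,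
      (∀ t ∈ I, ∀ᵐ x ∂μ,
        RLIntegralExists (1 - α x) (fun s => φ s x - φ 0 x) t ∧
        K t x = rlIntegral (1 - α x) (fun s => φ s x - φ 0 x) t) ∧
      ∀ t ∈ I, HasDerivWithinAt K (w t) I t

/-- `u ∈ C(I; L^p)` solves `cD_t^{α(x)} u = A u` on `I` with `u(0) = u₀`. -/
def IsSolutionOn {X : Type*} [MeasurableSpace X] {μ : Measure X} {p : ℝ≥0∞}
    [Fact (1 ≤ p)] (I : Set ℝ) (α : X → ℝ) (A : Lp ℝ p μ →L[ℝ] Lp ℝ p μ)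
    (u₀ : Lp ℝ p μ) (u : ℝ → Lp ℝ p μ) : Prop :=
  ContinuousOn u I ∧ HasCaputoDerivOn I α u (fun t => A (u t)) ∧ u 0 = u₀

/-- Multiplication by `g(x)` commutes with `A`: whenever `χ = g ψ` in `L^p`, `A χ = g (A ψ)`. -/
def CommutesWithMul {X : Type*} [MeasurableSpace X] {μ : Measure X} {p : ℝ≥0∞}
    [Fact (1 ≤ p)] (A : Lp ℝ p μ →L[ℝ] Lp ℝ p μ) (g : X → ℝ) : Prop :=
  ∀ ψ χ : Lp ℝ p μ, (χ =ᵐ[μ] fun x => g x * ψ x) → A χ =ᵐ[μ] fun x => g x * A ψ x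

/-- The `k`-th term `t^{kα(x)} (A^k u₀)(x) / Γ(kα(x) + 1)` of the Mittag-Leffler series. -/
def mlTerm {X : Type*} [MeasurableSpace X] {μ : Measure X} {p : ℝ≥0∞}
    [Fact (1 ≤ p)] (α : X → ℝ) (A : Lp ℝ p μ →L[ℝ] Lp ℝ p μ) (u₀ : Lp ℝ p μ)
    (k : ℕ) (t : ℝ) (x : X) : ℝ :=
  t ^ (α x * k) * (A ^ k) u₀ x / Real.Gamma (α x * k + 1)

/-- The terms of the Mittag-Leffler series at time `t` lie in `L^p`, and the series converges
in `L^p` to `S`. -/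
def HasMittagLefflerSum {X : Type*} [MeasurableSpace X] {μ : Measure X} {p : ℝ≥0∞}
    [Fact (1 ≤ p)] (α : X → ℝ) (A : Lp ℝ p μ →L[ℝ] Lp ℝ p μ) (u₀ : Lp ℝ p μ)
    (t : ℝ) (S : Lp ℝ p μ) : Prop :=
  ∃ F : ℕ → Lp ℝ p μ, (∀ k, F k =ᵐ[μ] mlTerm α A u₀ k t) ∧ HasSum F S

/-- The pointwise sum of the Mittag-Leffler series. -/
def mlSum {X : Type*} [MeasurableSpace X] {μ : Measure X} {p : ℝ≥0∞}
    [Fact (1 ≤ p)] (α : X → ℝ) (A : Lp ℝ p μ →L[ℝ] Lp ℝ p μ) (u₀ : Lp ℝ p μ)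
    (t : ℝ) (x : X) : ℝ :=
  ∑' k : ℕ, mlTerm α A u₀ k t x

end

open MeasureTheory Set
open scoped ENNReal

/-! Commutation. The functions `s^a / Γ(a + 1)` with `s = 1, 2` already separate the points of `[α₀,
1]`, since their quotient is `2^a`. The continuous `g` for which `A` commutes with multiplication by
`g(α(x))` form a closed subalgebra, so by Stone–Weierstrass they are all of them
(`mulOp_comm_of_separates`). Hence `A` passes through every coefficient of the series, and `A u` is
the Mittag-Leffler series of `A u₀` (`map_mlOp`).

Existence. The bound `Γ(y + 1) ≥ R^y e^{-R}` with `R` large gives a geometric majorant, uniform in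
`a ∈ [α₀, 1]` and in bounded `t`. By the Beta integral, `J^{1-a}` sends `t^{a(k+1)} / Γ(a(k+1) + 1)`
to the primitive of `t^{ak} / Γ(ak + 1)`. Thus `J^{1-α}[u - u₀]` is the primitive of the series of
`A u₀`, which is `A u` (`rlIntegral_mittagLeffler`, `isSolutionOn_mlOp`).

Uniqueness. A solution `v` has `K = A ∫ v`; applying `J^α` and `J^α J^{1-α} = J^1`
(`integral_mul_rlIntegral`) gives `∫ (v - u₀) = J^α (A ∫ v)`. The primitive of the difference of two
solutions then solves a homogeneous weakly singular Volterra equation and vanishes by Gronwall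
(`eq_zero_of_le_integral_sub_rpow`). Pointwise formulas in `x` and Bochner integrals are matched by
`ae_integrable_and_integral_eq`. -/

/-! ### Beta integrals and growth of the Gamma function -/

lemma integral_sub_rpow_mul_rpow {u v t : ℝ} (hu : 0 < u) (hv : 0 < v) (ht : 0 < t) :
    ∫ s in (0 : ℝ)..t, (t - s) ^ (u - 1) * s ^ (v - 1) =
      t ^ (u + v - 1) * (Real.Gamma u * Real.Gamma v / Real.Gamma (u + v)) := by
  have h := Complex.betaIntegral_scaled (v : ℂ) (u : ℂ) ht
  rw [Complex.betaIntegral_eq_Gamma_mul_div _ _ (by simpa using hv) (by simpa using hu)] at h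
  have h1 : ∫ x in (0 : ℝ)..t, (x : ℂ) ^ ((v : ℂ) - 1) * ((t : ℂ) - x) ^ ((u : ℂ) - 1) =
      ((∫ s in (0 : ℝ)..t, (t - s) ^ (u - 1) * s ^ (v - 1) : ℝ) : ℂ) := by
    rw [← intervalIntegral.integral_ofReal]
    refine intervalIntegral.integral_congr fun x hx => ?_
    rw [uIcc_of_le ht.le] at hx
    have h2 : 0 ≤ t - x := sub_nonneg.2 hx.2
    push_cast [Complex.ofReal_cpow hx.1, Complex.ofReal_cpow h2]
    ring
  rw [h1] at h
  apply Complex.ofReal_injective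
  rw [h, Complex.Gamma_ofReal, Complex.Gamma_ofReal, ← Complex.ofReal_add, Complex.Gamma_ofReal]
  push_cast [Complex.ofReal_cpow ht.le]
  rw [add_comm (v : ℂ) u, add_comm v u]
  ring

lemma intervalIntegrable_sub_rpow_mul_rpow {u v t : ℝ} (hu : 0 < u) (hv : 0 < v) (ht : 0 < t) :
    IntervalIntegrable (fun s => (t - s) ^ (u - 1) * s ^ (v - 1)) volume 0 t := by
  -- A non-integrable function has integral `0` by convention, but the Beta value is positive.
  by_contra h
  have h1 := integral_sub_rpow_mul_rpow hu hv ht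
  rw [intervalIntegral.integral_undef h] at h1
  have h2 : 0 < Real.Gamma u * Real.Gamma v / Real.Gamma (u + v) :=
    div_pos (mul_pos (Real.Gamma_pos_of_pos hu) (Real.Gamma_pos_of_pos hv))
      (Real.Gamma_pos_of_pos (by linarith))
  exact (mul_pos (Real.rpow_pos_of_pos ht _) h2).ne h1

lemma intervalIntegrable_sub_rpow {u : ℝ} (hu : 0 < u) (t : ℝ) :
    IntervalIntegrable (fun s => (t - s) ^ (u - 1)) volume 0 t := by
  have h := (intervalIntegral.intervalIntegrable_rpow' (a := 0) (b := t)
    (r := u - 1) (by linarith)).comp_sub_left t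
  simpa using h.symm

/-- Elementary lower bound for `Γ`. -/
lemma rpow_mul_exp_neg_le_Gamma {R y : ℝ} (hR : 0 ≤ R) (hy : 0 ≤ y) :
    R ^ y * Real.exp (-R) ≤ Real.Gamma (y + 1) := by
  have hpos : 0 < y + 1 := by linarith
  rw [Real.Gamma_eq_integral hpos]
  have hint := Real.GammaIntegral_convergent hpos
  simp only [add_sub_cancel_right] at hint ⊢
  have hint1 : IntegrableOn (fun x : ℝ => Real.exp (-x)) (Ioi R) := by
    simpa using integrableOn_exp_mul_Ioi (a := -1) (by norm_num) R
  have hint2 : IntegrableOn (fun x : ℝ => Real.exp (-x) * R ^ y) (Ioi R) :=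
    Integrable.mul_const hint1 _
  -- Keep only `x > R` in Euler's integral, where `x^y ≥ R^y`.
  calc R ^ y * Real.exp (-R) = ∫ x in Ioi R, Real.exp (-x) * R ^ y := by
        rw [integral_mul_const, integral_exp_neg_Ioi]; ring
    _ ≤ ∫ x in Ioi R, Real.exp (-x) * x ^ y := by
        refine setIntegral_mono_on hint2 (hint.mono_set (Ioi_subset_Ioi hR)) measurableSet_Ioi ?_
        intro x hx
        gcongr
        exact hx.le
    _ ≤ ∫ x in Ioi 0, Real.exp (-x) * x ^ y := by
        refine setIntegral_mono_set hint ?_ (Ioi_subset_Ioi hR).eventuallyLE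
        filter_upwards [ae_restrict_mem measurableSet_Ioi] with x hx
        have : (0 : ℝ) < x := hx
        simp only [Pi.zero_apply]
        positivity

lemma rpow_div_Gamma_le {t T R y : ℝ} (ht : 0 ≤ t) (htT : t ≤ T) (hR : 0 < R) (hy : 0 ≤ y) :
    t ^ y / Real.Gamma (y + 1) ≤ Real.exp R * (T / R) ^ y := by
  have hG : 0 < Real.Gamma (y + 1) := Real.Gamma_pos_of_pos (by linarith)
  rw [div_le_iff₀ hG]
  have h1 := rpow_mul_exp_neg_le_Gamma hR.le hy
  calc t ^ y ≤ T ^ y := Real.rpow_le_rpow ht htT hy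
    _ = Real.exp R * (T / R) ^ y * (R ^ y * Real.exp (-R)) := by
        rw [Real.div_rpow (ht.trans htT) hR.le, Real.exp_neg]
        field_simp
    _ ≤ _ := by
        have := ht.trans htT
        gcongr

/-- A summable majorant for the scalar Mittag-Leffler coefficients. -/
lemma exists_summable_bound_rpow_div_Gamma {a₀ : ℝ} (ha₀ : 0 < a₀) (T C : ℝ) :
    ∃ b : ℕ → ℝ, (∀ k, 0 ≤ b k) ∧ Summable (fun k => b k * C ^ k) ∧
      ∀ (k : ℕ) (a t : ℝ), a₀ ≤ a → 0 ≤ t → t ≤ T →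
        t ^ (a * k) / Real.Gamma (a * k + 1) ≤ b k := by
  set T' := max T 1 with hT'
  have hT'1 : 1 ≤ T' := le_max_right _ _
  -- `q` makes `|q C| < 1`, and `R` is tuned so that `(T' / R)^a₀ = q`. As `T' / R ≤ 1`, exponents
  -- `a ≥ a₀` only decrease the power, so `exp R * q^k` serves for all `a` at once.
  set q := (1 / (2 * (|C| + 1))) with hq
  have hq0 : 0 < q := by positivity
  have hq1 : q ≤ 1 := by
    rw [hq, div_le_one (by positivity)]; linarith [abs_nonneg C]
  set R := T' * q ^ (-(1 / a₀)) with hRdef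
  have hR : 0 < R := by positivity
  have hTR : T' / R = q ^ (1 / a₀) := by
    rw [hRdef, Real.rpow_neg hq0.le]; field_simp
  have hbase : (T' / R) ^ a₀ = q := by
    rw [hTR, ← Real.rpow_mul hq0.le, one_div_mul_cancel ha₀.ne', Real.rpow_one]
  have hTR1 : T' / R ≤ 1 := by
    rw [hTR]; exact Real.rpow_le_one hq0.le hq1 (by positivity)
  have hTR0 : 0 < T' / R := by positivity
  refine ⟨fun k => Real.exp R * q ^ k, fun k => by positivity, ?_, ?_⟩
  · have : (fun k : ℕ => Real.exp R * q ^ k * C ^ k) = fun k : ℕ => Real.exp R * (q * C) ^ k := by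
      ext k; rw [mul_pow]; ring
    rw [this]
    apply Summable.mul_left
    apply summable_geometric_of_abs_lt_one
    rw [abs_mul, abs_of_pos hq0, hq, one_div, inv_mul_lt_iff₀ (by positivity)]
    linarith [abs_nonneg C]
  · intro k a t ha ht htT
    have ha0 : 0 < a := ha₀.trans_le ha
    refine (rpow_div_Gamma_le ht (T := T') (htT.trans (le_max_left T 1)) hR (by positivity)).trans ?_
    refine mul_le_mul_of_nonneg_left ?_ (Real.exp_nonneg _)
    rw [← hbase, ← Real.rpow_natCast, ← Real.rpow_mul hTR0.le]
    exact Real.rpow_le_rpow_of_exponent_ge hTR0 hTR1 (by gcongr)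

/-! ### Scalar Mittag-Leffler series -/

section Scalar

open Filter Topology

variable {a : ℝ} {c : ℕ → ℝ}

lemma norm_mittagLeffler_term_le (ha : 0 < a) {t T : ℝ} (ht : 0 ≤ t) (htT : t ≤ T) (k : ℕ) :
    ‖t ^ (a * k) * c k / Real.Gamma (a * k + 1)‖ ≤
      T ^ (a * k) / Real.Gamma (a * k + 1) * |c k| := by
  have hG : 0 < Real.Gamma (a * k + 1) := Real.Gamma_pos_of_pos (by positivity)
  rw [mul_div_right_comm, Real.norm_eq_abs, abs_mul, abs_of_nonneg (by positivity)]
  gcongr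

lemma summable_mittagLeffler_term (ha : 0 < a)
    (hc : ∀ T : ℝ, 0 ≤ T → Summable fun k : ℕ => T ^ (a * k) / Real.Gamma (a * k + 1) * |c k|)
    {t : ℝ} (ht : 0 ≤ t) :
    Summable fun k : ℕ => t ^ (a * k) * c k / Real.Gamma (a * k + 1) :=
  Summable.of_norm_bounded (hc t ht) fun k => norm_mittagLeffler_term_le ha ht le_rfl k

lemma continuous_rpow_mul_nat (ha : 0 < a) (k : ℕ) : Continuous fun t : ℝ => t ^ (a * k) :=
  Real.continuous_rpow_const (by positivity)

lemma continuousOn_tsum_mittagLeffler (ha : 0 < a)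
    (hc : ∀ T : ℝ, 0 ≤ T → Summable fun k : ℕ => T ^ (a * k) / Real.Gamma (a * k + 1) * |c k|) :
    ContinuousOn (fun t : ℝ => ∑' k : ℕ, t ^ (a * k) * c k / Real.Gamma (a * k + 1)) (Ici 0) := by
  intro t (ht : 0 ≤ t)
  have h : ContinuousOn (fun t : ℝ => ∑' k : ℕ, t ^ (a * k) * c k / Real.Gamma (a * k + 1))
      (Icc 0 (t + 1)) := by
    refine continuousOn_tsum (fun k => ?_) (hc (t + 1) (by linarith))
      fun k s hs => norm_mittagLeffler_term_le ha hs.1 hs.2 k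
    exact (((continuous_rpow_mul_nat ha k).mul_const _).div_const _).continuousOn
  refine (h t ⟨ht, by linarith⟩).mono_of_mem_nhdsWithin ?_
  rw [← Ici_inter_Iic]
  exact inter_mem self_mem_nhdsWithin (mem_nhdsWithin_of_mem_nhds (Iic_mem_nhds (by linarith)))

lemma tsum_mittagLeffler_zero (ha : 0 < a) :
    ∑' k : ℕ, (0 : ℝ) ^ (a * k) * c k / Real.Gamma (a * k + 1) = c 0 := by
  rw [tsum_eq_single 0]
  · simp
  · intro k hk
    have : (0 : ℝ) < a * k := by positivity
    rw [Real.zero_rpow this.ne']; simp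

lemma hasSum_mittagLeffler_sub_zero (ha : 0 < a)
    (hc : ∀ T : ℝ, 0 ≤ T → Summable fun k : ℕ => T ^ (a * k) / Real.Gamma (a * k + 1) * |c k|)
    {t : ℝ} (ht : 0 ≤ t) :
    HasSum (fun k : ℕ => t ^ (a * (k + 1 : ℕ)) * c (k + 1) / Real.Gamma (a * (k + 1 : ℕ) + 1))
      ((∑' k : ℕ, t ^ (a * k) * c k / Real.Gamma (a * k + 1)) -
        ∑' k : ℕ, (0 : ℝ) ^ (a * k) * c k / Real.Gamma (a * k + 1)) := by
  have h := (hasSum_nat_add_iff' 1).2 (summable_mittagLeffler_term ha hc ht).hasSum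
  rw [tsum_mittagLeffler_zero ha]
  simpa using h

lemma hasSum_integral_mittagLeffler (ha : 0 < a)
    (hc : ∀ T : ℝ, 0 ≤ T → Summable fun k : ℕ => T ^ (a * k) / Real.Gamma (a * k + 1) * |c k|)
    {t : ℝ} (ht : 0 ≤ t) :
    HasSum (fun k : ℕ => t ^ (a * k + 1) / Real.Gamma (a * k + 2) * c k)
      (∫ s in (0 : ℝ)..t, ∑' k : ℕ, s ^ (a * k) * c k / Real.Gamma (a * k + 1)) := by
  have h := intervalIntegral.hasSum_integral_of_dominated_convergence (μ := volume) (a := 0) (b := t)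
    (F := fun (k : ℕ) (s : ℝ) => s ^ (a * k) * c k / Real.Gamma (a * k + 1))
    (f := fun s => ∑' k : ℕ, s ^ (a * k) * c k / Real.Gamma (a * k + 1))
    (fun (k : ℕ) _ => t ^ (a * k) / Real.Gamma (a * k + 1) * |c k|)
    (fun k => (((continuous_rpow_mul_nat ha k).mul_const _).div_const _).aestronglyMeasurable)
    (fun k => ae_of_all _ fun s hs => by
      rw [uIoc_of_le ht] at hs
      exact norm_mittagLeffler_term_le ha hs.1.le hs.2 k)
    (ae_of_all _ fun s _ => hc t ht) (by simp)
    (ae_of_all _ fun s hs => by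
      rw [uIoc_of_le ht] at hs
      exact (summable_mittagLeffler_term ha hc hs.1.le).hasSum)
  refine h.congr_fun fun k => ?_
  have hk : (0 : ℝ) < a * k + 1 := by positivity
  have hG := (Real.Gamma_pos_of_pos hk).ne'
  rw [intervalIntegral.integral_div, intervalIntegral.integral_mul_const,
    integral_rpow (Or.inl (by linarith)), Real.zero_rpow hk.ne', sub_zero,
    show a * (k : ℝ) + 2 = a * k + 1 + 1 by ring, Real.Gamma_add_one hk.ne']
  field_simp

/-- The fractional integral of order `1 - a` of a Mittag-Leffler series without its constant term
is the integral of the shifted series. -/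
lemma rlIntegral_mittagLeffler (ha : 0 < a) (ha1 : a ≤ 1)
    (hc : ∀ T : ℝ, 0 ≤ T → Summable fun k : ℕ => T ^ (a * k) / Real.Gamma (a * k + 1) * |c k|)
    (hc' : ∀ T : ℝ, 0 ≤ T →
      Summable fun k : ℕ => T ^ (a * k) / Real.Gamma (a * k + 1) * |c (k + 1)|)
    {t : ℝ} (ht : 0 ≤ t) :
    rlIntegral (1 - a)
      (fun s => (∑' k : ℕ, s ^ (a * k) * c k / Real.Gamma (a * k + 1)) -
        ∑' k : ℕ, (0 : ℝ) ^ (a * k) * c k / Real.Gamma (a * k + 1)) t =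
    ∫ s in (0 : ℝ)..t, ∑' k : ℕ, s ^ (a * k) * c (k + 1) / Real.Gamma (a * k + 1) := by
  have hS := hasSum_integral_mittagLeffler (c := fun k => c (k + 1)) ha hc' ht
  refine HasSum.unique ?_ hS
  -- At `a = 1` the fractional integral has order `0` and is the identity, so no kernel appears.
  rcases ha1.eq_or_lt with rfl | ha1
  · have h := hasSum_mittagLeffler_sub_zero ha hc ht
    simp only [rlIntegral, sub_self, if_true]
    convert h using 2 with k
    push_cast
    rw [one_mul, one_mul, show (k : ℝ) + 1 + 1 = k + 2 by ring]
    ring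
  rcases ht.eq_or_lt with rfl | ht
  · have hb : (1 - a) ≠ 0 := by linarith
    simp only [rlIntegral, hb, if_false, intervalIntegral.integral_same, mul_zero]
    convert hasSum_zero using 2 with k
    rw [Real.zero_rpow (by positivity)]; simp
  have hb : (1 - a) ≠ 0 := by linarith
  have hb0 : 0 < 1 - a := by linarith
  have hI := intervalIntegrable_sub_rpow hb0 t
  have hsum : Summable fun k : ℕ =>
      t ^ (a * (k + 1 : ℕ)) / Real.Gamma (a * (k + 1 : ℕ) + 1) * |c (k + 1)| :=
    (summable_nat_add_iff 1).2 (hc t ht.le)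
  have h := intervalIntegral.hasSum_integral_of_dominated_convergence (μ := volume) (a := 0) (b := t)
    (F := fun (k : ℕ) (s : ℝ) => (t - s) ^ (1 - a - 1) *
      (s ^ (a * (k + 1 : ℕ)) * c (k + 1) / Real.Gamma (a * (k + 1 : ℕ) + 1)))
    (f := fun s => (t - s) ^ (1 - a - 1) *
      ((∑' k : ℕ, s ^ (a * k) * c k / Real.Gamma (a * k + 1)) -
        ∑' k : ℕ, (0 : ℝ) ^ (a * k) * c k / Real.Gamma (a * k + 1)))
    (fun (k : ℕ) s => (t - s) ^ (1 - a - 1) *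
      (t ^ (a * (k + 1 : ℕ)) / Real.Gamma (a * (k + 1 : ℕ) + 1) * |c (k + 1)|))
    (fun k => by
      rw [uIoc_of_le ht.le]
      refine AEStronglyMeasurable.mul hI.1.aestronglyMeasurable ?_
      exact (((continuous_rpow_mul_nat ha _).mul_const _).div_const _).aestronglyMeasurable)
    (fun k => ae_of_all _ fun s hs => by
      rw [uIoc_of_le ht.le] at hs
      rw [norm_mul, Real.norm_of_nonneg (Real.rpow_nonneg (sub_nonneg.2 hs.2) _)]
      exact mul_le_mul_of_nonneg_left (norm_mittagLeffler_term_le ha hs.1.le hs.2 (k + 1))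
        (Real.rpow_nonneg (sub_nonneg.2 hs.2) _))
    (ae_of_all _ fun s _ => hsum.mul_left _)
    (by simp_rw [tsum_mul_left]; exact hI.mul_const _)
    (ae_of_all _ fun s hs => by
      rw [uIoc_of_le ht.le] at hs
      exact (hasSum_mittagLeffler_sub_zero ha hc hs.1.le).mul_left _)
  have h2 := h.mul_left (1 / Real.Gamma (1 - a))
  simp only [rlIntegral, hb, if_false]
  refine h2.congr_fun fun k => ?_
  have hv : (0 : ℝ) < a * (k + 1 : ℕ) + 1 := by positivity
  -- The factors `Γ(1 - a)` and `Γ(a(k+1) + 1)` cancel, leaving `t^{ak+1} / Γ(ak + 2)`.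
  have key := integral_sub_rpow_mul_rpow hb0 hv ht
  have hG := (Real.Gamma_pos_of_pos hv).ne'
  have hG2 := (Real.Gamma_pos_of_pos hb0).ne'
  rw [add_sub_cancel_right] at key
  have : ∀ s : ℝ, (t - s) ^ (1 - a - 1) *
      (s ^ (a * (k + 1 : ℕ)) * c (k + 1) / Real.Gamma (a * (k + 1 : ℕ) + 1)) =
      ((t - s) ^ (1 - a - 1) * s ^ (a * (k + 1 : ℕ))) *
        (c (k + 1) / Real.Gamma (a * (k + 1 : ℕ) + 1)) := fun s => by ring
  simp_rw [this]
  rw [intervalIntegral.integral_mul_const, key,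
    show 1 - a + (a * ((k + 1 : ℕ) : ℝ) + 1) - 1 = a * k + 1 by push_cast; ring,
    show 1 - a + (a * ((k + 1 : ℕ) : ℝ) + 1) = a * k + 2 by push_cast; ring]
  field_simp

lemma rlIntegralExists_of_continuousOn (ha1 : a ≤ 1) {f : ℝ → ℝ} {t : ℝ} (ht : 0 ≤ t)
    (hf : ContinuousOn f (Ici 0)) : RLIntegralExists (1 - a) f t := by
  rcases ha1.eq_or_lt with rfl | ha1
  · exact Or.inl (by simp)
  · right
    refine (intervalIntegrable_sub_rpow (by linarith) t).mul_continuousOn (hf.mono ?_)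
    rw [uIcc_of_le ht]
    exact Icc_subset_Ici_self

end Scalar

/-! ### Composition of fractional integrals and a singular Gronwall lemma -/

lemma integral_sub_rpow_mul_sub_rpow {u v r t : ℝ} (hu : 0 < u) (hv : 0 < v) (hrt : r < t) :
    ∫ s in r..t, (t - s) ^ (u - 1) * (s - r) ^ (v - 1) =
      (t - r) ^ (u + v - 1) * (Real.Gamma u * Real.Gamma v / Real.Gamma (u + v)) := by
  rw [← integral_sub_rpow_mul_rpow hu hv (sub_pos.2 hrt)]
  have := intervalIntegral.integral_comp_sub_right (a := r) (b := t)
    (fun s => (t - r - s) ^ (u - 1) * s ^ (v - 1)) r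
  rw [sub_self] at this
  rw [← this]
  congr 1
  ext s
  congr 2
  ring

lemma intervalIntegrable_sub_rpow_mul_sub_rpow {u v r t : ℝ} (hu : 0 < u) (hv : 0 < v)
    (hrt : r < t) :
    IntervalIntegrable (fun s => (t - s) ^ (u - 1) * (s - r) ^ (v - 1)) volume r t := by
  have := (intervalIntegrable_sub_rpow_mul_rpow hu hv (sub_pos.2 hrt)).comp_sub_right r
  rw [zero_add, sub_add_cancel] at this
  refine this.congr fun s _ => ?_
  congr 2
  ring

/-- `J^a J^(1-a) = J^1` on integrable functions. -/
lemma integral_mul_rlIntegral {a T : ℝ} (ha : 0 < a) (ha1 : a ≤ 1) {ψ : ℝ → ℝ}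
    (hψ : Integrable ψ (volume.restrict (Ioc 0 T))) :
    ∫ s in Ioc 0 T, (T - s) ^ (a - 1) / Real.Gamma a * rlIntegral (1 - a) ψ s =
      ∫ s in Ioc 0 T, ψ s := by
  rcases ha1.eq_or_lt with rfl | ha1
  · simp [rlIntegral]
  have hb0 : 0 < 1 - a := by linarith
  set ν := volume.restrict (Ioc 0 T) with hν
  set B := Real.Gamma a * Real.Gamma (1 - a) with hB
  have hBpos : 0 < B := mul_pos (Real.Gamma_pos_of_pos ha) (Real.Gamma_pos_of_pos hb0)
  -- Cutting off to the triangle `r < s` allows Fubini on the full square.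
  set k : ℝ × ℝ → ℝ := {z : ℝ × ℝ | z.2 < z.1}.indicator
    (fun z => (T - z.1) ^ (a - 1) * (z.1 - z.2) ^ (1 - a - 1)) with hk
  have hkm : Measurable k := by
    refine Measurable.indicator ?_ (measurableSet_lt measurable_snd measurable_fst)
    fun_prop
  have hkIoc : ∀ r, 0 < r → (fun s => k (s, r)) =
      (Ioi r).indicator fun s => (T - s) ^ (a - 1) * (s - r) ^ (1 - a - 1) := by
    intro r _
    ext s
    simp [hk, indicator]
  have hIoc : ∀ r, 0 < r → Ioc 0 T ∩ Ioi r = Ioc r T := by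
    intro r hr
    ext s
    simp only [mem_inter_iff, mem_Ioc, mem_Ioi]
    constructor <;> intro h <;> refine ⟨?_, ?_⟩ <;> try constructor
    all_goals linarith [h.1, h.2]
  have hrT : ∀ᵐ r ∂ν, 0 < r ∧ r < T := by
    filter_upwards [ae_restrict_mem measurableSet_Ioc,
      ae_restrict_of_ae (Measure.ae_ne volume T)] with r hr hne
    exact ⟨hr.1, lt_of_le_of_ne hr.2 hne⟩
  have hint : ∀ r, 0 < r → r < T → Integrable (fun s => k (s, r)) ν := by
    intro r hr hrT
    rw [hkIoc r hr, integrable_indicator_iff measurableSet_Ioi, IntegrableOn, hν,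
      Measure.restrict_restrict measurableSet_Ioi, inter_comm, hIoc r hr]
    exact (intervalIntegrable_sub_rpow_mul_sub_rpow ha hb0 hrT).1
  -- The exponents `a` and `1 - a` add to `1`, so this Beta integral does not depend on `r`.
  have hval : ∀ r, 0 < r → r < T → ∫ s, k (s, r) ∂ν = B := by
    intro r hr hrT
    rw [hkIoc r hr, hν, setIntegral_indicator measurableSet_Ioi, hIoc r hr,
      ← intervalIntegral.integral_of_le hrT.le, integral_sub_rpow_mul_sub_rpow ha hb0 hrT]
    simp [hB]
  have hk0 : ∀ s r, s ∈ Ioc 0 T → 0 ≤ k (s, r) := by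
    intro s r hs
    refine indicator_apply_nonneg fun (h : r < s) => ?_
    exact mul_nonneg (Real.rpow_nonneg (by linarith [hs.2]) _) (Real.rpow_nonneg (by simpa using h.le) _)
  have hF : Integrable (fun z : ℝ × ℝ => k z * ψ z.2) (ν.prod ν) := by
    have hm : AEStronglyMeasurable (fun z : ℝ × ℝ => k z * ψ z.2) (ν.prod ν) :=
      hkm.aestronglyMeasurable.mul hψ.aestronglyMeasurable.comp_snd
    rw [integrable_prod_iff' hm]
    constructor
    · filter_upwards [hrT] with r hr
      exact (hint r hr.1 hr.2).mul_const _
    · refine (hψ.norm.const_mul B).congr ?_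
      filter_upwards [hrT] with r hr
      rw [← hval r hr.1 hr.2, ← integral_mul_const]
      refine integral_congr_ae ?_
      filter_upwards [ae_restrict_mem measurableSet_Ioc] with s hs
      rw [norm_mul, Real.norm_of_nonneg (hk0 s r hs)]
  have hswap := integral_integral_swap (f := fun s r => k (s, r) * ψ r) hF
  have h1 : ∫ r, ∫ s, k (s, r) * ψ r ∂ν ∂ν = B * ∫ r, ψ r ∂ν := by
    rw [← integral_const_mul]
    refine integral_congr_ae ?_
    filter_upwards [hrT] with r hr
    rw [integral_mul_const, hval r hr.1 hr.2]
  have h2 : ∀ s ∈ Ioc 0 T, (T - s) ^ (a - 1) / Real.Gamma a * rlIntegral (1 - a) ψ s =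
      B⁻¹ * ∫ r, k (s, r) * ψ r ∂ν := by
    intro s hs
    have hkr : (fun r => k (s, r) * ψ r) =
        (Iio s).indicator fun r => (T - s) ^ (a - 1) * ((s - r) ^ (1 - a - 1) * ψ r) := by
      ext r
      simp only [hk, indicator, mem_ofPred_eq, mem_Iio]
      split_ifs <;> ring
    have hset : Ioc 0 T ∩ Iio s = Ioo 0 s := by
      ext r
      simp only [mem_inter_iff, mem_Ioc, mem_Iio, mem_Ioo]
      constructor
      · rintro ⟨⟨h1, h2⟩, h3⟩; exact ⟨h1, h3⟩
      · rintro ⟨h1, h3⟩; exact ⟨⟨h1, h3.le.trans hs.2⟩, h3⟩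
    rw [hkr, hν, setIntegral_indicator measurableSet_Iio, hset, integral_const_mul,
      ← integral_Ioc_eq_integral_Ioo, ← intervalIntegral.integral_of_le hs.1.le]
    simp only [rlIntegral, hb0.ne', if_false, hB]
    have := (Real.Gamma_pos_of_pos ha).ne'
    have := (Real.Gamma_pos_of_pos hb0).ne'
    field_simp
  rw [setIntegral_congr_fun measurableSet_Ioc h2, integral_const_mul, hswap, h1]
  field_simp

/-- Extending the integral to `(0, ∞)` gives a Gamma integral. The bound is uniform in `t` and small
for large `l`. -/
lemma integral_sub_rpow_mul_exp_le {δ l t : ℝ} (hδ : 0 < δ) (hl : 0 < l) (ht : 0 ≤ t) :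
    ∫ s in (0 : ℝ)..t, (t - s) ^ (δ - 1) * Real.exp (-(l * (t - s))) ≤
      (1 / l) ^ δ * Real.Gamma δ := by
  rw [intervalIntegral.integral_comp_sub_left
    (fun s => s ^ (δ - 1) * Real.exp (-(l * s))) t, sub_self, sub_zero,
    ← Real.integral_rpow_mul_exp_neg_mul_Ioi hδ hl, intervalIntegral.integral_of_le ht]
  refine setIntegral_mono_set ?_ ?_ Ioc_subset_Ioi_self.eventuallyLE
  · by_contra h
    have h1 := Real.integral_rpow_mul_exp_neg_mul_Ioi hδ hl
    rw [integral_undef h] at h1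
    exact (mul_pos (Real.rpow_pos_of_pos (one_div_pos.2 hl) δ) (Real.Gamma_pos_of_pos hδ)).ne h1
  · filter_upwards [ae_restrict_mem measurableSet_Ioi] with x (hx : 0 < x)
    simp only [Pi.zero_apply]
    positivity

/-- Gronwall's lemma for a weakly singular kernel, in the homogeneous case. -/
lemma eq_zero_of_le_integral_sub_rpow {δ C T : ℝ} (hδ : 0 < δ) (hC : 0 ≤ C) {y : ℝ → ℝ}
    (hy : ContinuousOn y (Icc 0 T)) (hy0 : ∀ t ∈ Icc 0 T, 0 ≤ y t)
    (h : ∀ t ∈ Icc 0 T, y t ≤ C * ∫ s in (0 : ℝ)..t, (t - s) ^ (δ - 1) * y s) :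
    ∀ t ∈ Icc 0 T, y t = 0 := by
  rcases lt_or_ge T 0 with hT | hT
  · intro t ht; linarith [ht.1, ht.2]
  have hG := Real.Gamma_pos_of_pos hδ
  -- `l` satisfies `(1 / l)^δ = 1 / D`, so in the weight `e^{-lt}` the integral operator has norm at
  -- most `C Γ(δ) / D ≤ 1/2`. The weighted maximum `m` then satisfies `m ≤ m / 2`.
  set D := 2 * (C * Real.Gamma δ) + 1 with hD
  have hD0 : 0 < D := by positivity
  set l := D ^ (1 / δ) with hl
  have hl0 : 0 < l := by positivity
  have hlδ : (1 / l) ^ δ = 1 / D := by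
    rw [one_div, Real.inv_rpow hl0.le, hl, ← Real.rpow_mul hD0.le, one_div_mul_cancel hδ.ne',
      Real.rpow_one, one_div]
  have hzc : ContinuousOn (fun t => Real.exp (-(l * t)) * y t) (Icc 0 T) :=
    (by fun_prop : Continuous fun t => Real.exp (-(l * t))).continuousOn.mul hy
  obtain ⟨t₀, ht₀, hmax⟩ := isCompact_Icc.exists_isMaxOn (nonempty_Icc.2 hT) hzc
  set m := Real.exp (-(l * t₀)) * y t₀ with hm
  have hle : ∀ s ∈ Icc 0 T, y s ≤ m * Real.exp (l * s) := by
    intro s hs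
    have h1 : Real.exp (-(l * s)) * y s ≤ m := hmax hs
    have h2 : Real.exp (-(l * s)) * Real.exp (l * s) = 1 := by
      rw [← Real.exp_add]; simp
    calc y s = (Real.exp (-(l * s)) * y s) * Real.exp (l * s) := by
          rw [mul_right_comm, h2, one_mul]
      _ ≤ _ := by gcongr
  have hm0 : 0 ≤ m := mul_nonneg (Real.exp_nonneg _) (hy0 _ ht₀)
  have hI := intervalIntegrable_sub_rpow hδ t₀
  have hsub : uIcc 0 t₀ ⊆ Icc 0 T := by
    rw [uIcc_of_le ht₀.1]; exact Icc_subset_Icc_right ht₀.2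
  have key : m ≤ m * (C * ((1 / l) ^ δ * Real.Gamma δ)) := by
    calc m ≤ Real.exp (-(l * t₀)) * (C * ∫ s in (0 : ℝ)..t₀, (t₀ - s) ^ (δ - 1) * y s) := by
          rw [hm]; gcongr; exact h t₀ ht₀
      _ ≤ Real.exp (-(l * t₀)) *
          (C * ∫ s in (0 : ℝ)..t₀, (t₀ - s) ^ (δ - 1) * (m * Real.exp (l * s))) := by
          gcongr
          refine intervalIntegral.integral_mono_on ht₀.1
            (hI.mul_continuousOn (hy.mono hsub)) (hI.mul_continuousOn (by fun_prop)) ?_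
          intro s hs
          have := hle s ⟨hs.1, hs.2.trans ht₀.2⟩
          have h3 : 0 ≤ t₀ - s := sub_nonneg.2 hs.2
          gcongr
      _ = m * (C * ∫ s in (0 : ℝ)..t₀, (t₀ - s) ^ (δ - 1) * Real.exp (-(l * (t₀ - s)))) := by
          have : ∀ s : ℝ, (t₀ - s) ^ (δ - 1) * Real.exp (-(l * (t₀ - s))) =
              ((t₀ - s) ^ (δ - 1) * Real.exp (l * s)) * Real.exp (-(l * t₀)) := by
            intro s
            rw [mul_assoc, ← Real.exp_add]; ring_nf
          simp_rw [this]
          have h2 : ∀ s : ℝ, (t₀ - s) ^ (δ - 1) * (m * Real.exp (l * s)) =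
              ((t₀ - s) ^ (δ - 1) * Real.exp (l * s)) * m := fun s => by ring
          simp_rw [h2]
          rw [intervalIntegral.integral_mul_const, intervalIntegral.integral_mul_const]
          ring
      _ ≤ _ := by
          gcongr
          exact integral_sub_rpow_mul_exp_le hδ hl0 ht₀.1
  have hhalf : C * ((1 / l) ^ δ * Real.Gamma δ) ≤ 1 / 2 := by
    rw [hlδ, one_div_mul_eq_div, mul_div_assoc', div_le_iff₀ hD0, hD]
    linarith
  have hmz : m = 0 := by nlinarith
  intro t ht
  refine le_antisymm ?_ (hy0 t ht)
  simpa [hmz] using hle t ht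

/-! ### Multiplication operators and Stone–Weierstrass -/

section Mul

variable {X : Type*} [MeasurableSpace X] {μ : Measure X} {p : ℝ≥0∞}
  {Y : Type*} [TopologicalSpace Y] [CompactSpace Y] [MeasurableSpace Y] [BorelSpace Y]
  {τ : X → Y}

lemma memLp_comp_mul (hτ : Measurable τ) (g : C(Y, ℝ)) (f : Lp ℝ p μ) :
    MemLp (fun x => g (τ x) * f x) p μ :=
  MemLp.of_le_mul (c := ‖g‖) (Lp.memLp f)
    ((g.continuous.measurable.comp hτ).aestronglyMeasurable.mul (Lp.aestronglyMeasurable f))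
    (ae_of_all _ fun x => by
      rw [norm_mul]
      exact mul_le_mul_of_nonneg_right (g.norm_coe_le_norm _) (norm_nonneg _))

variable [Fact (1 ≤ p)]

/-- Multiplication by `g ∘ τ` on `L^p`. -/
noncomputable def mulOp (hτ : Measurable τ) (g : C(Y, ℝ)) : Lp ℝ p μ →L[ℝ] Lp ℝ p μ :=
  LinearMap.mkContinuous
    { toFun := fun f => (memLp_comp_mul hτ g f).toLp
      map_add' := fun f₁ f₂ => by
        rw [← MemLp.toLp_add]
        refine MemLp.toLp_congr _ _ ?_
        filter_upwards [Lp.coeFn_add f₁ f₂] with x hx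
        rw [hx, Pi.add_apply, Pi.add_apply, mul_add]
      map_smul' := fun r f => by
        rw [← MemLp.toLp_const_smul]
        refine MemLp.toLp_congr _ _ ?_
        filter_upwards [Lp.coeFn_smul r f] with x hx
        simp only [hx, Pi.smul_apply, smul_eq_mul, RingHom.id_apply]
        ring } ‖g‖ fun f => by
      refine Lp.norm_le_mul_norm_of_ae_le_mul ?_
      filter_upwards [(memLp_comp_mul hτ g f).coeFn_toLp] with x hx
      simp only [LinearMap.coe_mk, AddHom.coe_mk]
      rw [hx, norm_mul]
      exact mul_le_mul_of_nonneg_right (g.norm_coe_le_norm _) (norm_nonneg _)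

lemma coeFn_mulOp (hτ : Measurable τ) (g : C(Y, ℝ)) (f : Lp ℝ p μ) :
    mulOp hτ g f =ᵐ[μ] fun x => g (τ x) * f x :=
  (memLp_comp_mul hτ g f).coeFn_toLp

lemma norm_mulOp_le (hτ : Measurable τ) (g : C(Y, ℝ)) :
    ‖(mulOp hτ g : Lp ℝ p μ →L[ℝ] Lp ℝ p μ)‖ ≤ ‖g‖ :=
  LinearMap.mkContinuous_norm_le _ (norm_nonneg _) _

/-- Multiplication by `g ∘ τ` as an algebra homomorphism in `g`. -/
noncomputable def mulOpHom (hτ : Measurable τ) : C(Y, ℝ) →ₐ[ℝ] (Lp ℝ p μ →L[ℝ] Lp ℝ p μ) :=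
  AlgHom.ofLinearMap
    { toFun := mulOp hτ
      map_add' := fun g₁ g₂ => by
        ext1 f
        refine Lp.ext ?_
        rw [add_apply]
        filter_upwards [coeFn_mulOp hτ (g₁ + g₂) f, coeFn_mulOp hτ g₁ f, coeFn_mulOp hτ g₂ f,
          Lp.coeFn_add (mulOp hτ g₁ f) (mulOp hτ g₂ f)] with x h1 h2 h3 h4
        rw [h1, h4, Pi.add_apply, h2, h3, ContinuousMap.add_apply, add_mul]
      map_smul' := fun r g => by
        ext1 f
        refine Lp.ext ?_
        rw [RingHom.id_apply, smul_apply]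
        filter_upwards [coeFn_mulOp hτ (r • g) f, coeFn_mulOp hτ g f,
          Lp.coeFn_smul r (mulOp hτ g f)] with x h1 h2 h3
        rw [h1, h3, Pi.smul_apply, h2, ContinuousMap.smul_apply, smul_eq_mul, smul_eq_mul,
          mul_assoc] }
    (by
      ext1 f
      refine Lp.ext ?_
      filter_upwards [coeFn_mulOp (μ := μ) (p := p) hτ 1 f] with x h1
      simp only [LinearMap.coe_mk, AddHom.coe_mk, one_apply_eq_self]
      rw [h1]; simp)
    (fun g₁ g₂ => by
      ext1 f
      refine Lp.ext ?_
      simp only [LinearMap.coe_mk, AddHom.coe_mk, mul_apply_eq_comp]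
      filter_upwards [coeFn_mulOp hτ (g₁ * g₂) f, coeFn_mulOp hτ g₁ (mulOp hτ g₂ f),
        coeFn_mulOp hτ g₂ f] with x h1 h2 h3
      rw [h1, h2, h3, ContinuousMap.mul_apply, mul_assoc])

lemma mulOpHom_apply (hτ : Measurable τ) (g : C(Y, ℝ)) :
    (mulOpHom hτ g : Lp ℝ p μ →L[ℝ] Lp ℝ p μ) = mulOp hτ g := rfl

lemma continuous_mulOp (hτ : Measurable τ) :
    Continuous (mulOp hτ : C(Y, ℝ) → (Lp ℝ p μ →L[ℝ] Lp ℝ p μ)) :=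
  (LinearMap.mkContinuous (mulOpHom hτ : C(Y, ℝ) →ₐ[ℝ] (Lp ℝ p μ →L[ℝ] Lp ℝ p μ)).toLinearMap 1
    fun g => by rw [one_mul]; exact norm_mulOp_le hτ g).continuous

/-- If `A` commutes with a separating family of multiplication operators, it commutes with all. -/
lemma mulOp_comm_of_separates (hτ : Measurable τ) (A : Lp ℝ p μ →L[ℝ] Lp ℝ p μ)
    (S : Set C(Y, ℝ)) (hS : ∀ g ∈ S, ∀ f, A (mulOp hτ g f) = mulOp hτ g (A f))
    (hsep : ∀ y z : Y, y ≠ z → ∃ g ∈ S, g y ≠ g z) (g : C(Y, ℝ)) (f : Lp ℝ p μ) :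
    A (mulOp hτ g f) = mulOp hτ g (A f) := by
  -- A preimage of a centralizer under an algebra homomorphism is a subalgebra; it is closed because
  -- `mulOp` is continuous from the sup norm to the operator norm.
  let C : Subalgebra ℝ C(Y, ℝ) := (Subalgebra.centralizer ℝ {A}).comap (mulOpHom hτ)
  have hmem : ∀ g, g ∈ C ↔ A * mulOp hτ g = mulOp hτ g * A := by
    intro g
    simp [C, Subalgebra.mem_comap, Subalgebra.mem_centralizer_iff, mulOpHom_apply]
  have hclosed : IsClosed (C : Set C(Y, ℝ)) := by
    have : (C : Set C(Y, ℝ)) = {g | A * mulOp hτ g = mulOp hτ g * A} := by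
      ext g; exact hmem g
    rw [this]
    exact isClosed_eq (continuous_const.mul (continuous_mulOp hτ))
      ((continuous_mulOp hτ).mul continuous_const)
  have hSC : S ⊆ C := fun g hg => (hmem g).2 (ContinuousLinearMap.ext fun f => hS g hg f)
  have htop := ContinuousMap.subalgebra_topologicalClosure_eq_top_of_separatesPoints C
    fun y z hyz => by
      obtain ⟨g, hg, hne⟩ := hsep y z hyz
      exact ⟨g, ⟨g, hSC hg, rfl⟩, hne⟩
  have hg : g ∈ C.topologicalClosure := by rw [htop]; trivial
  have hg' : g ∈ (C : Set C(Y, ℝ)) := by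
    rw [← hclosed.closure_eq, ← Subalgebra.topologicalClosure_coe]; exact hg
  exact DFunLike.congr_fun ((hmem g).1 hg') f

end Mul

/-! ### Bochner integrals in `L^p` computed pointwise -/

section Bochner

variable {X : Type*} [MeasurableSpace X] {μ : Measure X} {p : ℝ≥0∞} [hp : Fact (1 ≤ p)]

/-- Pairing with the indicator of `B` in the conjugate space, which covers `p = 1` and `p = ∞` too.
-/
lemma exists_clm_setIntegral {B : Set X} (hB : MeasurableSet B) (hμB : μ B ≠ ∞) :
    ∃ L : Lp ℝ p μ →L[ℝ] ℝ, ∀ f : Lp ℝ p μ, L f = ∫ x in B, f x ∂μ := by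
  have : Fact (1 ≤ ENNReal.conjExponent p) := ⟨by
    unfold ENNReal.conjExponent; exact le_self_add⟩
  have : ENNReal.HolderConjugate p (ENNReal.conjExponent p) := .conjExponent hp.out
  refine ⟨((ContinuousLinearMap.mul ℝ ℝ).lpPairing μ p (ENNReal.conjExponent p)).flip
    (indicatorConstLp (ENNReal.conjExponent p) hB hμB (1 : ℝ)), fun f => ?_⟩
  rw [ContinuousLinearMap.flip_apply, ContinuousLinearMap.lpPairing_eq_integral,
    ← integral_indicator hB]
  refine integral_congr_ae ?_
  filter_upwards [indicatorConstLp_coeFn (p := ENNReal.conjExponent p) (hs := hB) (hμs := hμB)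
    (c := (1 : ℝ))] with x hx
  rw [hx]
  simp [indicator]

lemma exists_setIntegral_abs_le {B : Set X} (hB : MeasurableSet B) (hμB : μ B ≠ ∞) :
    ∃ C : ℝ, ∀ f : Lp ℝ p μ, ∫ x in B, ‖f x‖ ∂μ ≤ C * ‖f‖ := by
  obtain ⟨L, hL⟩ := exists_clm_setIntegral (p := p) hB hμB
  refine ⟨‖L‖, fun f => ?_⟩
  have h : ∫ x in B, ‖f x‖ ∂μ = L |f| := by
    rw [hL]
    refine integral_congr_ae (ae_restrict_of_ae ?_)
    filter_upwards [Lp.coeFn_abs f] with x hx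
    rw [hx, Real.norm_eq_abs]
  rw [h, ← norm_abs_eq_norm f]
  exact (le_abs_self _).trans (L.le_opNorm _)

variable {S : Type*} [MeasurableSpace S] {ν : Measure S} [SigmaFinite μ]
  {f : S → Lp ℝ p μ} {φ : S → X → ℝ}

/-- On a set of finite measure the `L^1` norm is controlled by the `L^p` norm, so Tonelli applies.
-/
lemma integrable_uncurry_restrict (hf : Integrable f ν)
    (hφ : AEStronglyMeasurable (Function.uncurry φ) (ν.prod μ))
    (h : ∀ᵐ s ∂ν, φ s =ᵐ[μ] f s) {B : Set X} (hB : MeasurableSet B) (hμB : μ B ≠ ∞) :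
    Integrable (Function.uncurry φ) (ν.prod (μ.restrict B)) := by
  have hφB : AEStronglyMeasurable (Function.uncurry φ) (ν.prod (μ.restrict B)) := by
    refine hφ.mono_measure ?_
    exact Measure.prod_mono le_rfl Measure.restrict_le_self
  obtain ⟨C, hC⟩ := exists_setIntegral_abs_le (p := p) hB hμB
  rw [integrable_prod_iff hφB]
  constructor
  · filter_upwards [h] with s hs
    exact (integrableOn_Lp_of_measure_ne_top (f s) hp.out hμB).congr
      (Filter.EventuallyEq.symm (ae_restrict_of_ae hs))
  · refine (hf.norm.const_mul C).mono' hφB.norm.integral_prod_right' ?_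
    filter_upwards [h] with s hs
    rw [Real.norm_of_nonneg (integral_nonneg fun _ => norm_nonneg _)]
    refine le_trans (le_of_eq ?_) (hC (f s))
    refine integral_congr_ae (ae_restrict_of_ae ?_)
    filter_upwards [hs] with x hx
    simp [Function.uncurry, hx]

variable [SFinite ν]

/-- An `L^p`-valued Bochner integral is computed pointwise from a jointly measurable
representative of the integrand. -/
lemma ae_integrable_and_integral_eq (hf : Integrable f ν)
    (hφ : AEStronglyMeasurable (Function.uncurry φ) (ν.prod μ))
    (h : ∀ᵐ s ∂ν, φ s =ᵐ[μ] f s) :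
    ∀ᵐ x ∂μ, Integrable (fun s => φ s x) ν ∧ (∫ s, f s ∂ν : Lp ℝ p μ) x = ∫ s, φ s x ∂ν := by
  have h1 : ∀ᵐ x ∂μ, Integrable (fun s => φ s x) ν := by
    refine ae_of_forall_measure_lt_top_ae_restrict _ fun B hB hμB => ?_
    exact (integrable_uncurry_restrict hf hφ h hB hμB.ne).prod_left_ae
  have h2 : (∫ s, f s ∂ν : Lp ℝ p μ) =ᵐ[μ] fun x => ∫ s, φ s x ∂ν := by
    -- Test on sets of finite measure: integration over `B` is a continuous functional, so it
    -- commutes with the Bochner integral, and Fubini handles the pointwise side.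
    refine ae_eq_of_forall_setIntegral_eq_of_sigmaFinite
      (fun B _ hμB => integrableOn_Lp_of_measure_ne_top _ hp.out hμB.ne)
      (fun B hB hμB => (integrable_uncurry_restrict hf hφ h hB hμB.ne).integral_prod_right)
      fun B hB hμB => ?_
    obtain ⟨L, hL⟩ := exists_clm_setIntegral (p := p) hB hμB.ne
    rw [← hL, ← L.integral_comp_comm hf,
      ← integral_integral_swap (integrable_uncurry_restrict hf hφ h hB hμB.ne)]
    refine integral_congr_ae ?_
    filter_upwards [h] with s hs
    rw [hL]
    exact integral_congr_ae (ae_restrict_of_ae (Filter.EventuallyEq.symm hs))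
  filter_upwards [h1, h2] with x hx1 hx2 using ⟨hx1, hx2⟩

end Bochner

/-! ### The Mittag-Leffler series in `L^p` -/

lemma norm_clm_pow_apply_le {E : Type*} [NormedAddCommGroup E] [NormedSpace ℝ E]
    (A : E →L[ℝ] E) (k : ℕ) (x : E) : ‖(A ^ k) x‖ ≤ ‖A‖ ^ k * ‖x‖ := by
  induction k with
  | zero => simp
  | succ k ih =>
    rw [pow_succ', mul_apply_eq_comp, pow_succ', mul_assoc]
    exact (A.le_opNorm _).trans (mul_le_mul_of_nonneg_left ih (norm_nonneg _))

section MittagLeffler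

variable {X : Type*} [MeasurableSpace X] {μ : Measure X} {p : ℝ≥0∞} [hp : Fact (1 ≤ p)]
  {a₀ : ℝ} (ha₀ : 0 < a₀) {τ : X → Icc a₀ 1} (hτ : Measurable τ)
  (A : Lp ℝ p μ →L[ℝ] Lp ℝ p μ)

include ha₀ in
lemma continuous_mittagLeffler_coeff (k : ℕ) :
    Continuous fun z : ℝ × Icc a₀ 1 =>
      (max z.1 0) ^ ((z.2 : ℝ) * k) / Real.Gamma ((z.2 : ℝ) * k + 1) := by
  have hpos : ∀ z : ℝ × Icc a₀ 1, 0 < (z.2 : ℝ) := fun z => ha₀.trans_le z.2.2.1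
  have hpos' : ∀ z : ℝ × Icc a₀ 1, 0 < (z.2 : ℝ) * k + 1 := fun z => by
    have := hpos z; positivity
  have hΓ : Continuous fun z : ℝ × Icc a₀ 1 => Real.Gamma ((z.2 : ℝ) * k + 1) := by
    rw [continuous_iff_continuousAt]
    intro z
    refine ContinuousAt.comp (g := Real.Gamma)
      (f := fun z : ℝ × Icc a₀ 1 => (z.2 : ℝ) * k + 1) ?_ (by fun_prop)
    exact (Real.differentiableAt_Gamma fun m h => by
      have := hpos' z
      have : (0 : ℝ) ≤ m := m.cast_nonneg
      linarith).continuousAt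
  refine Continuous.div ?_ hΓ fun z => (Real.Gamma_pos_of_pos (hpos' z)).ne'
  -- For `k = 0` the exponent vanishes and `rpow` is not jointly continuous at `(0, 0)`, but the
  -- function is constant; for `k > 0` the exponent is positive.
  rcases Nat.eq_zero_or_pos k with rfl | hk
  · simpa using continuous_const
  · refine Continuous.rpow (by fun_prop) (by fun_prop) fun z => Or.inr ?_
    have := hpos z
    positivity

/-- The coefficient `t^{ak} / Γ(ak + 1)` as a continuous function of `a`, extended to `t < 0` by
its value at `0`. -/
noncomputable def mlCoeff (k : ℕ) : C(ℝ, C(Icc a₀ 1, ℝ)) :=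
  ContinuousMap.curry ⟨_, continuous_mittagLeffler_coeff ha₀ k⟩

lemma mlCoeff_apply (k : ℕ) {t : ℝ} (ht : 0 ≤ t) (a : Icc a₀ 1) :
    mlCoeff ha₀ k t a = t ^ ((a : ℝ) * k) / Real.Gamma ((a : ℝ) * k + 1) := by
  simp [mlCoeff, max_eq_left ht]

lemma exists_summable_bound_mlCoeff (T C : ℝ) :
    ∃ b : ℕ → ℝ, (∀ k, 0 ≤ b k) ∧ Summable (fun k => b k * C ^ k) ∧
      (∀ (k : ℕ) (t : ℝ), t ≤ T → ‖mlCoeff ha₀ k t‖ ≤ b k) ∧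
      ∀ (k : ℕ) (a t : ℝ), a₀ ≤ a → 0 ≤ t → t ≤ T →
        t ^ (a * k) / Real.Gamma (a * k + 1) ≤ b k := by
  obtain ⟨b, hb0, hbs, hb⟩ := exists_summable_bound_rpow_div_Gamma ha₀ (max T 0) C
  refine ⟨b, hb0, hbs, fun k t ht => ?_, fun k a t ha ht htT =>
    hb k a t ha ht (htT.trans (le_max_left _ _))⟩
  rw [ContinuousMap.norm_le _ (hb0 k)]
  intro a
  have ha : 0 < (a : ℝ) := ha₀.trans_le a.2.1
  have hG : 0 < Real.Gamma ((a : ℝ) * k + 1) := Real.Gamma_pos_of_pos (by positivity)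
  have hm : 0 ≤ max t 0 := le_max_right _ _
  have h := hb k a (max t 0) a.2.1 hm (max_le_max_right 0 ht)
  rwa [← mlCoeff_apply ha₀ k hm a, ← Real.norm_of_nonneg (r := mlCoeff ha₀ k (max t 0) a)
    (by rw [mlCoeff_apply ha₀ k hm a]; positivity),
    show mlCoeff ha₀ k (max t 0) a = mlCoeff ha₀ k t a by simp [mlCoeff]] at h

/-- The Mittag-Leffler series in `L^p`. -/
noncomputable def mlOp (u₀ : Lp ℝ p μ) (t : ℝ) : Lp ℝ p μ :=
  ∑' k : ℕ, mulOp hτ (mlCoeff ha₀ k t) ((A ^ k) u₀)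

lemma norm_mlOp_term_le (u₀ : Lp ℝ p μ) (k : ℕ) {t b : ℝ} (hb : ‖mlCoeff ha₀ k t‖ ≤ b) :
    ‖mulOp hτ (mlCoeff ha₀ k t) ((A ^ k) u₀)‖ ≤ b * ‖A‖ ^ k * ‖u₀‖ := by
  have hb0 : 0 ≤ b := (norm_nonneg _).trans hb
  calc _ ≤ ‖(mulOp hτ (mlCoeff ha₀ k t) : Lp ℝ p μ →L[ℝ] Lp ℝ p μ)‖ * ‖(A ^ k) u₀‖ :=
        ContinuousLinearMap.le_opNorm _ _
    _ ≤ b * (‖A‖ ^ k * ‖u₀‖) := by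
        gcongr
        · exact (norm_mulOp_le hτ _).trans hb
        · exact norm_clm_pow_apply_le A k u₀
    _ = _ := by ring

lemma summable_norm_mlOp_term (u₀ : Lp ℝ p μ) (t : ℝ) :
    Summable fun k : ℕ => ‖mulOp hτ (mlCoeff ha₀ k t) ((A ^ k) u₀)‖ := by
  obtain ⟨b, hb0, hbs, hb, -⟩ := exists_summable_bound_mlCoeff ha₀ t ‖A‖
  exact Summable.of_nonneg_of_le (fun _ => norm_nonneg _)
    (fun k => norm_mlOp_term_le ha₀ hτ A u₀ k (hb k t le_rfl)) (hbs.mul_right ‖u₀‖)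

lemma continuous_mlOp (u₀ : Lp ℝ p μ) : Continuous (mlOp ha₀ hτ A u₀) := by
  rw [continuous_iff_continuousAt]
  intro t
  obtain ⟨b, hb0, hbs, hb, -⟩ := exists_summable_bound_mlCoeff ha₀ (t + 1) ‖A‖
  have h : ContinuousOn (mlOp ha₀ hτ A u₀) (Iic (t + 1)) := by
    refine continuousOn_tsum (fun k => Continuous.continuousOn ?_) (hbs.mul_right ‖u₀‖)
      fun k s hs => norm_mlOp_term_le ha₀ hτ A u₀ k (hb k s hs)
    exact ((continuous_mulOp hτ).comp (mlCoeff ha₀ k).continuous).clm_apply continuous_const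
  exact h.continuousAt (Iic_mem_nhds (by linarith))

/-- `A` moves past each coefficient by `hA`, and `A A^k u₀ = A^k (A u₀)`. -/
lemma map_mlOp (hA : ∀ (g : C(Icc a₀ 1, ℝ)) (f : Lp ℝ p μ), A (mulOp hτ g f) = mulOp hτ g (A f))
    (u₀ : Lp ℝ p μ) (t : ℝ) : A (mlOp ha₀ hτ A u₀ t) = mlOp ha₀ hτ A (A u₀) t := by
  rw [mlOp, A.map_tsum (summable_norm_mlOp_term ha₀ hτ A u₀ t).of_norm, mlOp]
  refine tsum_congr fun k => ?_
  rw [hA, ← mul_apply_eq_comp, ← mul_apply_eq_comp, mul_assoc, ← pow_succ', pow_succ]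
  rfl

variable {α : X → ℝ} (hα : ∀ᵐ x ∂μ, α x = τ x)

include hα in
lemma mlOp_term_ae_eq (u₀ : Lp ℝ p μ) (k : ℕ) {t : ℝ} (ht : 0 ≤ t) :
    mulOp hτ (mlCoeff ha₀ k t) ((A ^ k) u₀) =ᵐ[μ] mlTerm α A u₀ k t := by
  filter_upwards [hα, coeFn_mulOp hτ (mlCoeff ha₀ k t) ((A ^ k) u₀)] with x hx h1
  rw [h1, mlCoeff_apply ha₀ k ht, mlTerm, hx]
  ring

include ha₀ hτ hα

lemma hasMittagLefflerSum_mlOp (u₀ : Lp ℝ p μ) {t : ℝ} (ht : 0 ≤ t) :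
    HasMittagLefflerSum α A u₀ t (mlOp ha₀ hτ A u₀ t) :=
  ⟨_, fun k => mlOp_term_ae_eq ha₀ hτ A hα u₀ k ht,
    (summable_norm_mlOp_term ha₀ hτ A u₀ t).of_norm.hasSum⟩

/-- Absolute convergence in `L^p` forces the norm sum and the pointwise sum to agree almost
everywhere. -/
lemma mlOp_ae_eq_mlSum (u₀ : Lp ℝ p μ) {t : ℝ} (ht : 0 ≤ t) :
    mlOp ha₀ hτ A u₀ t =ᵐ[μ] mlSum α A u₀ t := by
  filter_upwards [Lp.coeFn_tsum
    (tsum_enorm_ne_top_iff_summable_norm.2 (summable_norm_mlOp_term ha₀ hτ A u₀ t)),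
    ae_all_iff.2 fun k => mlOp_term_ae_eq ha₀ hτ A hα u₀ k ht] with x h1 h2
  rw [mlOp, h1, mlSum]
  exact tsum_congr h2

omit hτ in
/-- The pointwise Mittag-Leffler series converges absolutely at all times, for almost every `x`. -/
lemma ae_summable_abs_mittagLeffler (u₀ : Lp ℝ p μ) :
    ∀ᵐ x ∂μ, ∀ T : ℝ, 0 ≤ T →
      Summable fun k : ℕ => T ^ (α x * k) / Real.Gamma (α x * k + 1) * |(A ^ k) u₀ x| := by
  -- The null set must not depend on `T`. One majorant `∑ b k |A^k u₀|`, absolutely convergent in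
  -- `L^p`, serves all `T ≤ N`, and only countably many `N` are needed.
  have h : ∀ N : ℕ, ∀ᵐ x ∂μ, ∀ T : ℝ, 0 ≤ T → T ≤ N →
      Summable fun k : ℕ => T ^ (α x * k) / Real.Gamma (α x * k + 1) * |(A ^ k) u₀ x| := by
    intro N
    obtain ⟨b, hb0, hbs, -, hb⟩ := exists_summable_bound_mlCoeff ha₀ N ‖A‖
    have hs : Summable fun k : ℕ => ‖(b k • |(A ^ k) u₀| : Lp ℝ p μ)‖ := by
      refine Summable.of_nonneg_of_le (fun _ => norm_nonneg _) (fun k => ?_) (hbs.mul_right ‖u₀‖)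
      rw [norm_smul, norm_abs_eq_norm, Real.norm_of_nonneg (hb0 k), mul_assoc]
      exact mul_le_mul_of_nonneg_left (norm_clm_pow_apply_le A k u₀) (hb0 k)
    filter_upwards [Lp.hasSum_coeFn_tsum (tsum_enorm_ne_top_iff_summable_norm.2 hs), hα,
      ae_all_iff.2 fun k => Lp.coeFn_smul (b k) |(A ^ k) u₀|,
      ae_all_iff.2 fun k => Lp.coeFn_abs ((A ^ k) u₀)] with x hx hαx h1 h2 T hT hTN
    have ha : 0 < α x := by rw [hαx]; exact ha₀.trans_le (τ x).2.1
    refine Summable.of_nonneg_of_le (fun k => ?_) (fun k => ?_) hx.summable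
    · have : 0 < Real.Gamma (α x * k + 1) := Real.Gamma_pos_of_pos (by positivity)
      positivity
    · rw [h1, Pi.smul_apply, h2, smul_eq_mul]
      gcongr
      exact hb k _ T (by rw [hαx]; exact (τ x).2.1) hT hTN
  filter_upwards [ae_all_iff.2 h] with x hx T hT
  obtain ⟨N, hN⟩ := exists_nat_ge T
  exact hx N T hT hN

/-- An a.e. limit of partial sums written with the measurable `τ` in place of `α`. -/
lemma aestronglyMeasurable_mlSum [SigmaFinite μ] (u₀ : Lp ℝ p μ) {I : Set ℝ}
    (hI : MeasurableSet I) (hI0 : I ⊆ Ici 0) :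
    AEStronglyMeasurable (Function.uncurry (mlSum α A u₀)) ((volume.restrict I).prod μ) := by
  set F : ℕ → ℝ × X → ℝ := fun k z =>
    max z.1 0 ^ ((τ z.2 : ℝ) * k) / Real.Gamma ((τ z.2 : ℝ) * k + 1) * (A ^ k) u₀ z.2
  have hF : ∀ k, AEStronglyMeasurable (F k) ((volume.restrict I).prod μ) := by
    intro k
    refine AEStronglyMeasurable.mul (Measurable.aestronglyMeasurable ?_)
      (Lp.aestronglyMeasurable _).comp_snd
    exact (continuous_mittagLeffler_coeff ha₀ k).measurable.comp
      (measurable_fst.prodMk (hτ.comp measurable_snd))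
  refine aestronglyMeasurable_of_tendsto_ae Filter.atTop
    (f := fun n z => ∑ k ∈ Finset.range n, F k z)
    (fun n => Finset.aestronglyMeasurable_fun_sum _ fun k _ => hF k) ?_
  have h1 : ∀ᵐ z ∂((volume.restrict I).prod μ), z.1 ∈ I :=
    Measure.quasiMeasurePreserving_fst.ae (ae_restrict_mem hI)
  have h2 := (Measure.quasiMeasurePreserving_snd (μ := volume.restrict I) (ν := μ)).ae
    (hα.and (ae_summable_abs_mittagLeffler ha₀ A hα u₀))
  filter_upwards [h1, h2] with z hz1 ⟨hz2, hz3⟩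
  have hz0 : 0 ≤ z.1 := hI0 hz1
  have ha : 0 < α z.2 := by rw [hz2]; exact ha₀.trans_le (τ z.2).2.1
  have hs := (summable_mittagLeffler_term ha hz3 hz0).hasSum.tendsto_sum_nat
  refine hs.congr fun n => Finset.sum_congr rfl fun k _ => ?_
  simp only [F]
  rw [max_eq_left hz0, hz2]
  ring

end MittagLeffler

/-! ### Existence -/

section Existence

variable {X : Type*} [MeasurableSpace X] {μ : Measure X} {p : ℝ≥0∞} [hp : Fact (1 ≤ p)]
  {a₀ : ℝ} (ha₀ : 0 < a₀) {τ : X → Icc a₀ 1} (hτ : Measurable τ)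
  (A : Lp ℝ p μ →L[ℝ] Lp ℝ p μ) {α : X → ℝ} (hα : ∀ᵐ x ∂μ, α x = τ x)

include ha₀ hα

lemma ae_summable_mlTerm (u₀ : Lp ℝ p μ) :
    ∀ᵐ x ∂μ, ∀ t : ℝ, 0 ≤ t → Summable fun k => mlTerm α A u₀ k t x := by
  filter_upwards [hα, ae_summable_abs_mittagLeffler ha₀ A hα u₀] with x hx h t ht
  exact summable_mittagLeffler_term (by rw [hx]; exact ha₀.trans_le (τ x).2.1) h ht

lemma ae_continuousOn_mlSum (u₀ : Lp ℝ p μ) :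
    ∀ᵐ x ∂μ, ContinuousOn (fun t => mlSum α A u₀ t x) (Ici 0) := by
  filter_upwards [hα, ae_summable_abs_mittagLeffler ha₀ A hα u₀] with x hx h
  exact continuousOn_tsum_mittagLeffler (by rw [hx]; exact ha₀.trans_le (τ x).2.1) h

lemma ae_rlIntegralExists_mlSum (u₀ : Lp ℝ p μ) :
    ∀ᵐ x ∂μ, ∀ t : ℝ, 0 ≤ t →
      RLIntegralExists (1 - α x) (fun s => mlSum α A u₀ s x - mlSum α A u₀ 0 x) t := by
  filter_upwards [hα, ae_continuousOn_mlSum ha₀ A hα u₀] with x hx h t ht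
  exact rlIntegralExists_of_continuousOn (by rw [hx]; exact (τ x).2.2) ht
    (h.sub continuousOn_const)

lemma ae_rlIntegral_mlSum (u₀ : Lp ℝ p μ) :
    ∀ᵐ x ∂μ, ∀ t : ℝ, 0 ≤ t →
      rlIntegral (1 - α x) (fun s => mlSum α A u₀ s x - mlSum α A u₀ 0 x) t =
        ∫ s in (0 : ℝ)..t, mlSum α A (A u₀) s x := by
  have hpow : ∀ k : ℕ, (A ^ k) (A u₀) = (A ^ (k + 1)) u₀ := fun k => by
    rw [pow_succ]; rfl
  filter_upwards [hα, ae_summable_abs_mittagLeffler ha₀ A hα u₀,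
    ae_summable_abs_mittagLeffler ha₀ A hα (A u₀)] with x hx h h' t ht
  simp_rw [hpow] at h'
  simp_rw [mlSum, mlTerm, hpow]
  exact rlIntegral_mittagLeffler (c := fun k => (A ^ k) u₀ x)
    (by rw [hx]; exact ha₀.trans_le (τ x).2.1) (by rw [hx]; exact (τ x).2.2) h h' ht

/-- The pointwise Caputo derivative of the Mittag-Leffler series. -/
lemma ae_hasDerivWithinAt_rlIntegral_mlSum (u₀ : Lp ℝ p μ) :
    ∀ᵐ x ∂μ, ∀ t : ℝ, 0 ≤ t →
      HasDerivWithinAt (rlIntegral (1 - α x) (fun s => mlSum α A u₀ s x - mlSum α A u₀ 0 x))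
        (mlSum α A (A u₀) t x) (Ici 0) t := by
  filter_upwards [ae_rlIntegral_mlSum ha₀ A hα u₀, ae_continuousOn_mlSum ha₀ A hα (A u₀)]
    with x h hc t ht
  -- Freezing the integrand for `s < 0` makes it continuous on the whole line, so the two-sided
  -- fundamental theorem applies even at `t = 0`.
  set g : ℝ → ℝ := fun s => mlSum α A (A u₀) (max s 0) x with hg
  have hgc : Continuous g :=
    hc.comp_continuous (by fun_prop) fun s => le_max_right s 0
  have hd : HasDerivAt (fun t => ∫ s in (0 : ℝ)..t, g s) (g t) t :=
    (hgc.integral_hasStrictDerivAt 0 t).hasDerivAt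
  have hgt : g t = mlSum α A (A u₀) t x := by simp only [hg]; rw [max_eq_left ht]
  rw [← hgt]
  have heq : ∀ r ∈ Ici (0 : ℝ),
      rlIntegral (1 - α x) (fun s => mlSum α A u₀ s x - mlSum α A u₀ 0 x) r =
        ∫ s in (0 : ℝ)..r, g s := by
    intro r hr
    rw [h r hr]
    refine intervalIntegral.integral_congr fun s hs => ?_
    rw [uIcc_of_le hr] at hs
    simp only [hg]
    rw [max_eq_left hs.1]
  exact hd.hasDerivWithinAt.congr heq (heq t ht)

variable [SigmaFinite μ]

/-- The Mittag-Leffler series solves the fractional evolution equation. -/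
lemma isSolutionOn_mlOp
    (hA : ∀ (g : C(Icc a₀ 1, ℝ)) (f : Lp ℝ p μ), A (mulOp hτ g f) = mulOp hτ g (A f))
    (u₀ : Lp ℝ p μ) : IsSolutionOn (Ici 0) α A u₀ (mlOp ha₀ hτ A u₀) := by
  refine ⟨(continuous_mlOp ha₀ hτ A u₀).continuousOn, ⟨mlSum α A u₀,
    ⟨aestronglyMeasurable_mlSum ha₀ hτ A hα u₀ measurableSet_Ici subset_rfl, fun t ht =>
      (mlOp_ae_eq_mlSum ha₀ hτ A hα u₀ ht).symm⟩,
    -- `K` is the Bochner primitive of the series of `A u₀`, and `map_mlOp` identifies its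
    -- derivative with `A u`.
    fun t => ∫ s in (0 : ℝ)..t, mlOp ha₀ hτ A (A u₀) s, fun t ht => ?_, fun t ht => ?_⟩, ?_⟩
  · have ht0 : 0 ≤ t := ht
    have hI := ((continuous_mlOp ha₀ hτ A (A u₀)).intervalIntegrable (μ := volume) 0 t).1
    have h := ae_integrable_and_integral_eq (ν := volume.restrict (Ioc 0 t)) hI
      (aestronglyMeasurable_mlSum ha₀ hτ A hα (A u₀) measurableSet_Ioc fun s hs => hs.1.le)
      (by
        filter_upwards [ae_restrict_mem measurableSet_Ioc] with s hs
        exact (mlOp_ae_eq_mlSum ha₀ hτ A hα (A u₀) hs.1.le).symm)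
    filter_upwards [ae_rlIntegralExists_mlSum ha₀ A hα u₀, ae_rlIntegral_mlSum ha₀ A hα u₀, h]
      with x h1 h2 h3
    refine ⟨h1 t ht, ?_⟩
    rw [h2 t ht, intervalIntegral.integral_of_le ht0, intervalIntegral.integral_of_le ht0, h3.2]
  · simp only [map_mlOp ha₀ hτ A hA]
    exact ((continuous_mlOp ha₀ hτ A (A u₀)).integral_hasStrictDerivAt 0 t).hasDerivAt.hasDerivWithinAt
  · refine Lp.ext ?_
    filter_upwards [mlOp_ae_eq_mlSum ha₀ hτ A hα u₀ le_rfl, hα] with x h hx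
    rw [h]
    simpa [mlSum, mlTerm] using tsum_mittagLeffler_zero (c := fun k => (A ^ k) u₀ x)
      (a := α x) (by rw [hx]; exact ha₀.trans_le (τ x).2.1)

end Existence

/-! ### Measurability of fractional integrals of variable order -/

/-- The reciprocal of `Γ` is entire, so the poles need no separate treatment. -/
lemma continuous_inv_Gamma : Continuous fun s : ℝ => (Real.Gamma s)⁻¹ := by
  have h := Complex.continuous_re.comp
    (Complex.differentiable_one_div_Gamma.continuous.comp Complex.continuous_ofReal)
  refine h.congr fun s => ?_
  simp only [Function.comp_apply, Complex.Gamma_ofReal]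
  rw [← Complex.ofReal_inv, Complex.ofReal_re]

section Measurability

variable {X : Type*} [MeasurableSpace X]

lemma measurable_setIntegral_rlKernel {b : X → ℝ} (hb : Measurable b) {ψ : ℝ × X → ℝ}
    (hψ : Measurable ψ) :
    Measurable fun z : ℝ × X =>
      ∫ r in Ioc 0 z.1, (z.1 - r) ^ (b z.2 - 1) * ψ (r, z.2) := by
  set S : Set ((ℝ × X) × ℝ) := {w | 0 < w.2 ∧ w.2 ≤ w.1.1} with hS
  have hSm : MeasurableSet S :=
    (measurableSet_lt measurable_const measurable_snd).inter
      (measurableSet_le measurable_snd (measurable_fst.comp measurable_fst))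
  have hf : Measurable (S.indicator fun w : (ℝ × X) × ℝ =>
      (w.1.1 - w.2) ^ (b w.1.2 - 1) * ψ (w.2, w.1.2)) := by
    refine Measurable.indicator ?_ hSm
    refine Measurable.mul (Measurable.pow (by fun_prop) (by fun_prop)) (by fun_prop)
  have h := (hf.stronglyMeasurable.integral_prod_right' (ν := (volume : Measure ℝ))).measurable
  convert h using 2 with z
  rw [← integral_indicator measurableSet_Ioc]
  refine integral_congr_ae (ae_of_all _ fun r => ?_)
  simp [hS, indicator]

/-- Joint measurability of fractional integrals of variable order. -/
lemma aestronglyMeasurable_rlIntegral {μ : Measure X} [SFinite μ] {b : X → ℝ} (hb : Measurable b)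
    {ψ : ℝ × X → ℝ} (hψ : Measurable ψ) (T : ℝ) :
    AEStronglyMeasurable (fun z : ℝ × X => rlIntegral (b z.2) (fun s => ψ (s, z.2)) z.1)
      ((volume.restrict (Ioc 0 T)).prod μ) := by
  have hm : Measurable fun z : ℝ × X => if b z.2 = 0 then ψ z else
      (Real.Gamma (b z.2))⁻¹ * ∫ r in Ioc 0 z.1, (z.1 - r) ^ (b z.2 - 1) * ψ (r, z.2) := by
    refine Measurable.ite (measurableSet_eq_fun (by fun_prop) measurable_const) hψ ?_
    exact (continuous_inv_Gamma.measurable.comp (hb.comp measurable_snd)).mul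
      (measurable_setIntegral_rlKernel hb hψ)
  refine hm.aestronglyMeasurable.congr ?_
  have h1 : ∀ᵐ z ∂((volume.restrict (Ioc 0 T)).prod μ), z.1 ∈ Ioc 0 T :=
    Measure.quasiMeasurePreserving_fst.ae (ae_restrict_mem measurableSet_Ioc)
  filter_upwards [h1] with z hz
  rw [rlIntegral, intervalIntegral.integral_of_le hz.1.le, one_div]

end Measurability

/-- Order `0` evaluates the function at `t` itself, hence the separate `ht'`. -/
lemma rlIntegral_congr_of_ae {β : ℝ} {f g : ℝ → ℝ} {t T : ℝ} (ht : t ∈ Ioc 0 T)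
    (h : ∀ᵐ s ∂(volume.restrict (Ioc 0 T)), f s = g s) (ht' : f t = g t) :
    rlIntegral β f t = rlIntegral β g t := by
  unfold rlIntegral
  split_ifs
  · exact ht'
  · rw [intervalIntegral.integral_of_le ht.1.le, intervalIntegral.integral_of_le ht.1.le]
    congr 1
    refine integral_congr_ae ?_
    filter_upwards [ae_restrict_of_ae_restrict_of_subset (Ioc_subset_Ioc_right ht.2) h] with s hs
    rw [hs]

/-! ### Uniqueness through a Volterra equation -/

section Uniqueness

variable {X : Type*} [MeasurableSpace X] {μ : Measure X} {p : ℝ≥0∞} [hp : Fact (1 ≤ p)]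
  {a₀ : ℝ} (ha₀ : 0 < a₀) {τ : X → Icc a₀ 1} (hτ : Measurable τ)
  (A : Lp ℝ p μ →L[ℝ] Lp ℝ p μ)

include ha₀ in
-- Splitting off `r^{a₀/2 - 1}` instead of `r^{a₀ - 1}` keeps the remaining exponent at least `a₀/2
-- > 0`, so continuity survives at `r = 0`.
lemma continuous_rlCoeff :
    Continuous fun z : ℝ × Icc a₀ 1 =>
      (max z.1 0) ^ ((z.2 : ℝ) - a₀ / 2) * (Real.Gamma (z.2 : ℝ))⁻¹ := by
  refine Continuous.mul ?_ (continuous_inv_Gamma.comp (by fun_prop))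
  refine Continuous.rpow (by fun_prop) (by fun_prop) fun z => Or.inr ?_
  linarith [z.2.2.1]

/-- The regular part `r^{a - a₀/2} / Γ(a)` of the kernel of the fractional integral of order `a`,
as a continuous function of `a`. -/
noncomputable def rlCoeff : C(ℝ, C(Icc a₀ 1, ℝ)) :=
  ContinuousMap.curry ⟨_, continuous_rlCoeff ha₀⟩

lemma rpow_mul_rlCoeff {r : ℝ} (hr : 0 < r) (a : Icc a₀ 1) :
    r ^ (a₀ / 2 - 1) * rlCoeff ha₀ r a = r ^ ((a : ℝ) - 1) / Real.Gamma a := by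
  simp only [rlCoeff, ContinuousMap.curry_apply, ContinuousMap.coe_mk]
  rw [max_eq_left hr.le, ← mul_assoc, ← Real.rpow_add hr, div_eq_mul_inv]
  ring_nf

lemma continuous_mulOp_rlCoeff (T : ℝ) :
    Continuous fun s => (mulOp hτ (rlCoeff ha₀ (T - s)) : Lp ℝ p μ →L[ℝ] Lp ℝ p μ) :=
  (continuous_mulOp hτ).comp ((rlCoeff ha₀).continuous.comp (by fun_prop))

lemma intervalIntegrable_rlKernel {F : ℝ → Lp ℝ p μ} {T : ℝ} (hT : 0 ≤ T)
    (hF : ContinuousOn F (Ici 0)) :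
    IntervalIntegrable (fun s => (T - s) ^ (a₀ / 2 - 1) • mulOp hτ (rlCoeff ha₀ (T - s)) (F s))
      volume 0 T := by
  refine (intervalIntegrable_sub_rpow (half_pos ha₀) T).smul_continuousOn ?_
  refine ((continuous_mulOp_rlCoeff ha₀ hτ T).continuousOn).clm_apply (hF.mono ?_)
  rw [uIcc_of_le hT]
  exact Icc_subset_Ici_self

variable {α : X → ℝ} (hα : ∀ᵐ x ∂μ, α x = τ x) [SigmaFinite μ]

include hα in
/-- Applying the fractional integral of order `α(x)` to that of order `1 - α(x)`. -/
lemma integral_rlKernel_eq {v K : ℝ → Lp ℝ p μ} {φ : ℝ → X → ℝ}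
    (hv : Continuous v) (hφ : IsRepresentative (Ici 0) v φ) (hK : ContinuousOn K (Ici 0))
    (hKφ : ∀ t ∈ Ici (0 : ℝ), ∀ᵐ x ∂μ,
      K t x = rlIntegral (1 - α x) (fun s => φ s x - φ 0 x) t)
    {T : ℝ} (hT : 0 ≤ T) :
    ∫ s in (0 : ℝ)..T, (T - s) ^ (a₀ / 2 - 1) • mulOp hτ (rlCoeff ha₀ (T - s)) (K s) =
      ∫ s in (0 : ℝ)..T, (v s - v 0) := by
  set ν := volume.restrict (Ioc 0 T) with hν
  have hφm : AEStronglyMeasurable (fun z : ℝ × X => φ z.1 z.2 - φ 0 z.2) (ν.prod μ) := by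
    refine AEStronglyMeasurable.sub (hφ.1.mono_measure ?_) ?_
    · exact Measure.prod_mono (Measure.restrict_mono (fun s hs => hs.1.le) le_rfl) le_rfl
    · exact ((Lp.aestronglyMeasurable (v 0)).congr
        (hφ.2 0 self_mem_Ici).symm).comp_snd
  -- A measurable version of `φ - φ 0`. Fubini gives agreement in both orders: `hψ2` is used under
  -- the fractional integral, `hψ1` at its endpoint.
  set ψ := hφm.mk with hψdef
  have hψm : Measurable ψ := hφm.stronglyMeasurable_mk.measurable
  have hψ1 : ∀ᵐ s ∂ν, ∀ᵐ x ∂μ, φ s x - φ 0 x = ψ (s, x) :=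
    Measure.ae_ae_of_ae_prod hφm.ae_eq_mk
  have hψ2 : ∀ᵐ x ∂μ, ∀ᵐ s ∂ν, φ s x - φ 0 x = ψ (s, x) :=
    Measure.ae_ae_of_ae_prod
      ((Measure.measurePreserving_swap (μ := μ) (ν := ν)).quasiMeasurePreserving.ae hφm.ae_eq_mk)
  set κ : ℝ → X → ℝ := fun s x => rlIntegral (1 - (τ x : ℝ)) (fun r => ψ (r, x)) s with hκ
  have hκm : AEStronglyMeasurable (Function.uncurry κ) (ν.prod μ) :=
    aestronglyMeasurable_rlIntegral (b := fun x => 1 - (τ x : ℝ)) (by fun_prop) hψm T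
  have hκK : ∀ᵐ s ∂ν, κ s =ᵐ[μ] K s := by
    filter_upwards [hψ1, ae_restrict_mem measurableSet_Ioc] with s hs1 hs
    filter_upwards [hs1, hψ2, hα, hKφ s hs.1.le] with x h1 h2 h3 h4
    rw [h4, h3]
    exact (rlIntegral_congr_of_ae hs h2 h1).symm
  have hne : ∀ᵐ s ∂ν, s ∈ Ioc 0 T ∧ s ≠ T := by
    filter_upwards [ae_restrict_mem measurableSet_Ioc,
      ae_restrict_of_ae (Measure.ae_ne volume T)] with s h1 h2 using ⟨h1, h2⟩
  have hleft := ae_integrable_and_integral_eq (ν := ν)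
    (φ := fun s x => (T - s) ^ (a₀ / 2 - 1) * (rlCoeff ha₀ (T - s) (τ x) * κ s x))
    (intervalIntegrable_rlKernel ha₀ hτ hT hK).1
    (by
      refine AEStronglyMeasurable.mul (Measurable.aestronglyMeasurable (by fun_prop))
        (AEStronglyMeasurable.mul (Measurable.aestronglyMeasurable ?_) hκm)
      exact (continuous_rlCoeff ha₀).measurable.comp
        ((measurable_const.sub measurable_fst).prodMk (hτ.comp measurable_snd)))
    (by
      filter_upwards [hκK] with s hs
      filter_upwards [hs, Lp.coeFn_smul ((T - s) ^ (a₀ / 2 - 1))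
        (mulOp hτ (rlCoeff ha₀ (T - s)) (K s)), coeFn_mulOp hτ (rlCoeff ha₀ (T - s)) (K s)]
        with x h1 h2 h3
      rw [h2, Pi.smul_apply, h3, h1, smul_eq_mul])
  have hright := ae_integrable_and_integral_eq (ν := ν) (f := fun s => v s - v 0)
    (φ := fun s x => ψ (s, x))
    ((hv.sub continuous_const).intervalIntegrable (μ := volume) 0 T).1
    hψm.aestronglyMeasurable
    (by
      filter_upwards [hψ1, ae_restrict_mem measurableSet_Ioc] with s h1 hs
      filter_upwards [h1, hφ.2 s hs.1.le, hφ.2 0 self_mem_Ici, Lp.coeFn_sub (v s) (v 0)]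
        with x h1 h2 h3 h4
      rw [← h1, h4, Pi.sub_apply, h2, h3])
  rw [intervalIntegral.integral_of_le hT, intervalIntegral.integral_of_le hT]
  refine Lp.ext ?_
  filter_upwards [hleft, hright] with x h1 h2
  rw [h1.2, h2.2, ← integral_mul_rlIntegral (ha₀.trans_le (τ x).2.1) (τ x).2.2 h2.1]
  refine integral_congr_ae ?_
  filter_upwards [hne] with s hs
  have hpos : 0 < T - s := sub_pos.2 (lt_of_le_of_ne hs.1.2 hs.2)
  rw [← mul_assoc, rpow_mul_rlCoeff ha₀ hpos]

include hα in
-- Since `K 0 = 0` and `K' = A v`, `K` is `A` applied to the primitive of `v`.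
lemma IsSolutionOn.integral_rlKernel_eq {u₀ : Lp ℝ p μ} {v : ℝ → Lp ℝ p μ}
    (h : IsSolutionOn (Ici 0) α A u₀ v) (hv : Continuous v) {T : ℝ} (hT : 0 ≤ T) :
    ∫ s in (0 : ℝ)..T, (T - s) ^ (a₀ / 2 - 1) •
        mulOp hτ (rlCoeff ha₀ (T - s)) (A (∫ r in (0 : ℝ)..s, v r)) =
      ∫ s in (0 : ℝ)..T, (v s - u₀) := by
  obtain ⟨-, ⟨φ, hφ, K, hKφ, hK⟩, h0⟩ := h
  have hKc : ContinuousOn K (Ici 0) := fun t ht => (hK t ht).continuousWithinAt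
  have hKφ' : ∀ t ∈ Ici (0 : ℝ), ∀ᵐ x ∂μ,
      K t x = rlIntegral (1 - α x) (fun s => φ s x - φ 0 x) t := fun t ht =>
    (hKφ t ht).mono fun x hx => hx.2
  have hK0 : K 0 = 0 := by
    refine Lp.ext ?_
    filter_upwards [hKφ' 0 self_mem_Ici, Lp.coeFn_zero ℝ p μ] with x hx hz
    rw [hx, hz]
    simp [rlIntegral]
  have hKint : ∀ s, 0 ≤ s → K s = A (∫ r in (0 : ℝ)..s, v r) := by
    intro s hs
    rw [← A.intervalIntegral_comp_comm (hv.intervalIntegrable _ _),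
      intervalIntegral.integral_eq_sub_of_hasDeriv_right_of_le hs
        (hKc.mono Icc_subset_Ici_self)
        (fun x hx => (hK x hx.1.le).mono (fun y (hy : x < y) => (hx.1.trans hy).le))
        ((A.continuous.comp hv).intervalIntegrable _ _), hK0, sub_zero]
  rw [← h0, ← _root_.integral_rlKernel_eq ha₀ hτ hα hv hφ hKc hKφ' hT]
  refine intervalIntegral.integral_congr fun s hs => ?_
  rw [uIcc_of_le hT] at hs
  rw [hKint s hs.1]

omit [SigmaFinite μ] in
-- Freezing a solution at negative times makes it globally continuous, hence its primitive
-- differentiable everywhere.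
lemma IsSolutionOn.comp_max {u₀ : Lp ℝ p μ} {v : ℝ → Lp ℝ p μ}
    (h : IsSolutionOn (Ici 0) α A u₀ v) :
    IsSolutionOn (Ici 0) α A u₀ (fun t => v (max t 0)) ∧ Continuous fun t => v (max t 0) := by
  obtain ⟨hc, ⟨φ, hφ, K, hKφ, hK⟩, h0⟩ := h
  have hcont : Continuous fun t => v (max t 0) :=
    hc.comp_continuous (by fun_prop) fun t => le_max_right t 0
  refine ⟨⟨hcont.continuousOn, ⟨φ, ⟨hφ.1, fun t ht => ?_⟩, K, hKφ, fun t ht => ?_⟩, ?_⟩, hcont⟩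
  · simpa only [max_eq_left (mem_Ici.1 ht)] using hφ.2 t ht
  · simpa only [max_eq_left (mem_Ici.1 ht)] using hK t ht
  · simpa using h0

include ha₀ hτ hα in
lemma IsSolutionOn.eq {u₀ : Lp ℝ p μ} {v u : ℝ → Lp ℝ p μ}
    (hv' : IsSolutionOn (Ici 0) α A u₀ v) (hu' : IsSolutionOn (Ici 0) α A u₀ u) {t : ℝ}
    (ht : 0 ≤ t) : v t = u t := by
  obtain ⟨hvs, hv⟩ := hv'.comp_max
  obtain ⟨hus, hu⟩ := hu'.comp_max
  set w : ℝ → Lp ℝ p μ := fun t => v (max t 0) - u (max t 0) with hw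
  have hwc : Continuous w := hv.sub hu
  set W : ℝ → Lp ℝ p μ := fun t => ∫ s in (0 : ℝ)..t, w s with hW
  have hWd : ∀ t, HasDerivAt W (w t) t := fun t => (hwc.integral_hasStrictDerivAt 0 t).hasDerivAt
  have hWc : Continuous W := continuous_iff_continuousAt.2 fun t => (hWd t).continuousAt
  have hprim : ∀ {f : ℝ → Lp ℝ p μ}, Continuous f →
      ContinuousOn (fun s => A (∫ r in (0 : ℝ)..s, f r)) (Ici 0) := fun hf =>
    (A.continuous.comp (continuous_iff_continuousAt.2 fun t =>
      (hf.integral_hasStrictDerivAt 0 t).hasDerivAt.continuousAt)).continuousOn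
  have hvol : ∀ T, 0 ≤ T → W T = ∫ s in (0 : ℝ)..T, (T - s) ^ (a₀ / 2 - 1) •
      mulOp hτ (rlCoeff ha₀ (T - s)) (A (W s)) := by
    intro T hT
    have h1 := hvs.integral_rlKernel_eq ha₀ hτ A hα hv hT
    have h2 := hus.integral_rlKernel_eq ha₀ hτ A hα hu hT
    have i1 : IntervalIntegrable (fun s => v (max s 0) - u₀) volume 0 T :=
      (hv.sub continuous_const).intervalIntegrable _ _
    have i2 : IntervalIntegrable (fun s => u (max s 0) - u₀) volume 0 T :=
      (hu.sub continuous_const).intervalIntegrable _ _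
    have h3 : W T = (∫ s in (0 : ℝ)..T, (v (max s 0) - u₀)) -
        ∫ s in (0 : ℝ)..T, (u (max s 0) - u₀) := by
      rw [← intervalIntegral.integral_sub i1 i2]
      refine intervalIntegral.integral_congr fun s _ => ?_
      simp [hw]
    rw [h3, ← h1, ← h2, ← intervalIntegral.integral_sub
      (intervalIntegrable_rlKernel ha₀ hτ hT (hprim hv))
      (intervalIntegrable_rlKernel ha₀ hτ hT (hprim hu))]
    refine intervalIntegral.integral_congr fun s _ => ?_
    simp only [hW, hw]
    rw [intervalIntegral.integral_sub (hv.intervalIntegrable _ _) (hu.intervalIntegrable _ _),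
      A.map_sub, ContinuousLinearMap.map_sub, smul_sub]
  have hzero : ∀ T, 0 ≤ T → W T = 0 := by
    intro T hT
    -- `C` bounds the regular part of the kernel, uniformly in `a`, leaving only the scalar
    -- singularity `(r - s)^{a₀/2 - 1}` for Gronwall.
    obtain ⟨C, hC⟩ := isCompact_Icc.exists_bound_of_continuousOn (s := Icc 0 T)
      (rlCoeff ha₀).continuous.continuousOn
    have hC0 : 0 ≤ C := (norm_nonneg _).trans (hC 0 ⟨le_rfl, hT⟩)
    have hgr := eq_zero_of_le_integral_sub_rpow (half_pos ha₀) (mul_nonneg hC0 (norm_nonneg A))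
      (T := T) (y := fun s => ‖W s‖) hWc.norm.continuousOn (fun _ _ => norm_nonneg _) ?_
    · exact norm_eq_zero.1 (hgr T ⟨hT, le_rfl⟩)
    intro r hr
    rw [hvol r hr.1, ← intervalIntegral.integral_const_mul]
    refine intervalIntegral.norm_integral_le_of_norm_le hr.1 (ae_of_all _ fun s hs => ?_)
      (((intervalIntegrable_sub_rpow (half_pos ha₀) r).mul_continuousOn
        hWc.norm.continuousOn).const_mul _)
    have hrs : 0 ≤ r - s := sub_nonneg.2 hs.2
    rw [norm_smul, Real.norm_of_nonneg (Real.rpow_nonneg hrs _)]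
    calc (r - s) ^ (a₀ / 2 - 1) * ‖mulOp hτ (rlCoeff ha₀ (r - s)) (A (W s))‖
        ≤ (r - s) ^ (a₀ / 2 - 1) * (C * (‖A‖ * ‖W s‖)) := by
          refine mul_le_mul_of_nonneg_left ?_ (Real.rpow_nonneg hrs _)
          refine (ContinuousLinearMap.le_opNorm _ _).trans ?_
          refine mul_le_mul ((norm_mulOp_le hτ _).trans (hC _ ⟨hrs, ?_⟩)) (A.le_opNorm _)
            (norm_nonneg _) hC0
          linarith [hs.1, hr.2]
      _ = _ := by ring
  have hd : HasDerivWithinAt W 0 (Ici 0) t :=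
    (hasDerivWithinAt_const t (Ici 0) (0 : Lp ℝ p μ)).congr hzero (hzero t ht)
  have hwt : w t = 0 := (uniqueDiffOn_Ici (0 : ℝ) t ht).eq_deriv _ (hWd t).hasDerivWithinAt hd
  simp only [hw, max_eq_left ht] at hwt
  exact sub_eq_zero.1 hwt

end Uniqueness

/-- `A` commutes with multiplication by continuous functions of `α` as soon as it commutes with
multiplication by `s^α / Γ(α + 1)` for every `s ≥ 0`. -/
lemma mulOp_comm_of_commutesWithMul {X : Type*} [MeasurableSpace X] {μ : Measure X} {p : ℝ≥0∞}
    [Fact (1 ≤ p)] {a₀ : ℝ} (ha₀ : 0 < a₀) {τ : X → Icc a₀ 1} (hτ : Measurable τ)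
    (A : Lp ℝ p μ →L[ℝ] Lp ℝ p μ) {α : X → ℝ} (hα : ∀ᵐ x ∂μ, α x = τ x)
    (h : ∀ s : ℝ, 0 ≤ s → CommutesWithMul A (fun x => s ^ α x / Real.Gamma (α x + 1)))
    (g : C(Icc a₀ 1, ℝ)) (f : Lp ℝ p μ) : A (mulOp hτ g f) = mulOp hτ g (A f) := by
  refine mulOp_comm_of_separates hτ A {g | ∃ s : ℝ, 0 ≤ s ∧ g = mlCoeff ha₀ 1 s} ?_ ?_ g f
  · rintro _ ⟨s, hs, rfl⟩ f
    have hcoe : ∀ f : Lp ℝ p μ, mulOp hτ (mlCoeff ha₀ 1 s) f =ᵐ[μ]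
        fun x => s ^ α x / Real.Gamma (α x + 1) * f x := by
      intro f
      filter_upwards [coeFn_mulOp hτ (mlCoeff ha₀ 1 s) f, hα] with x hx hαx
      rw [hx, mlCoeff_apply ha₀ 1 hs, hαx, Nat.cast_one, mul_one]
    exact Lp.ext ((h s hs f _ (hcoe f)).trans (hcoe (A f)).symm)
  · intro y z hyz
    by_contra! hne
    -- Equality at `s = 1` equates the Gamma factors; equality at `s = 2` then gives `2^y = 2^z`.
    have h1 := hne _ ⟨1, zero_le_one, rfl⟩
    have h2 := hne _ ⟨2, zero_le_two, rfl⟩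
    have hy : 0 < (y : ℝ) := ha₀.trans_le y.2.1
    have hG : Real.Gamma ((y : ℝ) * (1 : ℕ) + 1) ≠ 0 :=
      (Real.Gamma_pos_of_pos (by positivity)).ne'
    rw [mlCoeff_apply ha₀ 1 zero_le_one, mlCoeff_apply ha₀ 1 zero_le_one, Real.one_rpow,
      Real.one_rpow, one_div, one_div, inv_inj] at h1
    rw [mlCoeff_apply ha₀ 1 zero_le_two, mlCoeff_apply ha₀ 1 zero_le_two, ← h1,
      div_left_inj' hG, Nat.cast_one, mul_one, mul_one] at h2
    exact hyz (Subtype.ext ((Real.strictMono_rpow_of_base_gt_one one_lt_two).injective h2))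

theorem theorem3p4 (n : ℕ) (Ω : Set (EuclideanSpace ℝ (Fin n))) (hΩ : IsOpen Ω)
    (p : ℝ≥0∞) [Fact (1 ≤ p)]
    (α : EuclideanSpace ℝ (Fin n) → ℝ) (hα : MemLp α ∞ (volume.restrict Ω))
    (α₀ : ℝ) (hα₀ : α₀ ∈ Ioo (0 : ℝ) 1)
    (hαbd : ∀ᵐ x ∂(volume.restrict Ω), α x ∈ Icc α₀ 1)
    (A : Lp ℝ p (volume.restrict Ω) →L[ℝ] Lp ℝ p (volume.restrict Ω))
    (u₀ : Lp ℝ p (volume.restrict Ω))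
    (hcomm : ∀ s : ℝ, 0 ≤ s →
      CommutesWithMul A (fun x => s ^ α x / Real.Gamma (α x + 1))) :
    ∃ u : ℝ → Lp ℝ p (volume.restrict Ω),
      -- the series converges in `L^p` to `u t`, also pointwise
      (∀ t : ℝ, 0 ≤ t → HasMittagLefflerSum α A u₀ t (u t)) ∧
      (∀ᵐ x ∂(volume.restrict Ω), ∀ t : ℝ, 0 ≤ t → Summable fun k => mlTerm α A u₀ k t x) ∧
      (∀ t : ℝ, 0 ≤ t → u t =ᵐ[volume.restrict Ω] mlSum α A u₀ t) ∧
      -- it is the unique solution on `[0, ∞)`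
      IsSolutionOn (Ici 0) α A u₀ u ∧
      (∀ v : ℝ → Lp ℝ p (volume.restrict Ω), IsSolutionOn (Ici 0) α A u₀ v →
        ∀ t : ℝ, 0 ≤ t → v t = u t) ∧
      -- its sum also satisfies the equation with the Caputo derivative taken pointwise in `x`
      (∀ᵐ x ∂(volume.restrict Ω), ∀ t : ℝ, 0 ≤ t →
        RLIntegralExists (1 - α x) (fun s => mlSum α A u₀ s x - mlSum α A u₀ 0 x) t) ∧
      (∀ t : ℝ, 0 ≤ t → ∀ᵐ x ∂(volume.restrict Ω),
        HasDerivWithinAt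
          (rlIntegral (1 - α x) (fun s => mlSum α A u₀ s x - mlSum α A u₀ 0 x))
          (A (u t) x) (Ici 0) t) := by
  have ha₀ : 0 < α₀ := hα₀.1
  -- A measurable version of `α` with all its values in the compact interval, as Stone–Weierstrass
  -- requires.
  let τ : EuclideanSpace ℝ (Fin n) → Icc α₀ 1 := fun x => projIcc α₀ 1 hα₀.2.le (hα.1.mk α x)
  have hτ : Measurable τ :=
    continuous_projIcc.measurable.comp hα.1.stronglyMeasurable_mk.measurable
  have hατ : ∀ᵐ x ∂(volume.restrict Ω), α x = τ x := by
    filter_upwards [hα.1.ae_eq_mk, hαbd] with x h1 h2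
    simp only [τ]
    rw [← h1, projIcc_of_mem _ h2]
  have hA := mulOp_comm_of_commutesWithMul ha₀ hτ A hατ hcomm
  have hsol := isSolutionOn_mlOp ha₀ hτ A hατ hA u₀
  refine ⟨mlOp ha₀ hτ A u₀, fun t ht => hasMittagLefflerSum_mlOp ha₀ hτ A hατ u₀ ht,
    ae_summable_mlTerm ha₀ A hατ u₀, fun t ht => mlOp_ae_eq_mlSum ha₀ hτ A hατ u₀ ht, hsol,
    fun v hv t ht => hv.eq ha₀ hτ A hατ hsol ht, ae_rlIntegralExists_mlSum ha₀ A hατ u₀,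
    fun t ht => ?_⟩
  filter_upwards [ae_hasDerivWithinAt_rlIntegral_mlSum ha₀ A hατ u₀,
    mlOp_ae_eq_mlSum ha₀ hτ A hατ (A u₀) ht] with x h1 h2
  rw [map_mlOp ha₀ hτ A hA, h2]
  exact h1 t ht
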